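/- Fix $a\in(0,1)$. Consider closed filled rhombi in $\mathbb{R}^2$ with axis-parallel diagonals: a horizontal rhombus has ratio width : height equal to $1:a$, a vertical one has ratio width : height equal to $a:1$. The gasket construction starts with the horizontal rhombus of height $2$ and width $2/a$ centred at the origin, whose interior is regarded as empty space. At each iteration $k=1,2,\dots$, the largest possible rhombus, vertical if $k$ is odd and horizontal if $k$ is even, is placed into (the closure of) each region of empty space; the connected components of what remains of the empty space are the new regions, and their closures are called the empty polygons at iteration $k$. Let $F^a_k$ be the union of the empty polygons at iteration $k$, and let $F^a=\bigcap_{k=1}^\infty F^a_k$. A contact point is a point where a vertical rhombus of the construction touches a horizontal one (the initial rhombus included), i.e. a common point of their boundaries; let $C^a$ be the set of all contact points. A Jordan curve is a continuous map $\gamma:[0,1]\to\mathbb{R}^2$ such that $\gamma(0)=\gamma(1)$ and $\gamma$ is injective on $[0,1)$. Theorem. There is a continuous function $f:(0,1)\times[0,1]\to\mathbb{R}^2$ such that for each $a\in(0,1)$ the map $t\mapsto f(a,t)$ is a Jordan curve whose image is $F^a$. Furthermore, for every $a\in(0,1)$, the set $F^a$ is the closure of $C^a$. -/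

import Mathlib

open Set

noncomputable section

namespace Gasket

/-- The Euclidean plane `ℝ²`. -/
abbrev Plane : Type := EuclideanSpace ℝ (Fin 2)

/-- The two orientations of the rhombi in the construction. -/
inductive Orientation where
  | horizontal
  | vertical

/-- The closed filled rhombus with centre `c`, axis-parallel diagonals and aspect ratio `a`, whose
longer diagonal has length `2 * s` and whose shorter diagonal has length `2 * a * s`.
If it is horizontal, its vertices are `c ± (s, 0)` and `c ± (0, a * s)`;
if it is vertical, its vertices are `c ± (a * s, 0)` and `c ± (0, s)`. -/
def rhombus (a : ℝ) : Orientation → Plane → ℝ → Set Plane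
  | .horizontal, c, s => {p | a * |p 0 - c 0| + |p 1 - c 1| ≤ a * s}
  | .vertical, c, s => {p | |p 0 - c 0| + a * |p 1 - c 1| ≤ a * s}

/-- The horizontal rhombus of height `2` and width `2 / a`, centred at the origin. -/
def initialRhombus (a : ℝ) : Set Plane := rhombus a .horizontal 0 (1 / a)

/-- `R` is a largest possible rhombus of orientation `o` contained in `E`. -/
def IsLargestRhombus (a : ℝ) (o : Orientation) (E R : Set Plane) : Prop :=
  ∃ c : Plane, ∃ s : ℝ, 0 < s ∧ R = rhombus a o c s ∧ R ⊆ E ∧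
    ∀ (c' : Plane) (s' : ℝ), rhombus a o c' s' ⊆ E → s' ≤ s

/-- The orientation of the rhombi placed at iteration `k`: vertical for odd `k`, horizontal for
even `k`. -/
def orientationAt (k : ℕ) : Orientation := if Odd k then .vertical else .horizontal

/-- The open regions ("empty space") present after iteration `k`. At the start this is the interior
of the initial rhombus. At iteration `k + 1` a largest possible rhombus of the current orientation
is placed into (the closure of) every region, and the connected components of what is left of the
region are the new regions. -/
def emptyRegions (a : ℝ) : ℕ → Set (Set Plane)
  | 0 => {interior (initialRhombus a)}
  | k + 1 => {W | ∃ U ∈ emptyRegions a k, ∃ R,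
      IsLargestRhombus a (orientationAt (k + 1)) (closure U) R ∧
      ∃ x ∈ U \ R, W = connectedComponentIn (U \ R) x}

/-- The empty polygons at iteration `k` (for `k ≥ 1`), closed and filled. -/
def emptyPolygons (a : ℝ) (k : ℕ) : Set (Set Plane) := closure '' emptyRegions a k

/-- The union `F^a_k` of all the empty polygons at iteration `k`. -/
def gasketStage (a : ℝ) (k : ℕ) : Set Plane := ⋃₀ emptyPolygons a k

/-- The gasket set `F^a`, the intersection of all `F^a_k` with `k ≥ 1`. -/
def gasket (a : ℝ) : Set Plane := ⋂ k ≥ 1, gasketStage a k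

/-- `IsConstructionRhombus a o R`: the set `R` is a rhombus of orientation `o` occurring in the
construction, that is, the initial horizontal rhombus or a rhombus placed into one of the regions
at some iteration. -/
inductive IsConstructionRhombus (a : ℝ) : Orientation → Set Plane → Prop
  | initial : IsConstructionRhombus a .horizontal (initialRhombus a)
  | placed (k : ℕ) (U R : Set Plane) (hU : U ∈ emptyRegions a k)
      (hR : IsLargestRhombus a (orientationAt (k + 1)) (closure U) R) :
      IsConstructionRhombus a (orientationAt (k + 1)) R

/-- The set `C^a` of all contact points: the points where a vertical rhombus of the construction
touches a horizontal one. Since all other rhombi lie inside the initial rhombus,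
touching means that the boundaries meet. -/
def contactPoints (a : ℝ) : Set Plane :=
  {p | ∃ V H, IsConstructionRhombus a .vertical V ∧ IsConstructionRhombus a .horizontal H ∧
    p ∈ frontier V ∩ frontier H}

/-- `γ`, restricted to `[0, 1]`, is a Jordan curve: a simple closed plane curve. -/
def IsJordanCurve (γ : ℝ → Plane) : Prop :=
  ContinuousOn γ (Icc 0 1) ∧ γ 0 = γ 1 ∧ InjOn γ (Ico 0 1)

end Gasket

end

open Set

noncomputable section

namespace Gasket

open Filter Topology

/-! Up to similarity only three empty regions ever occur: the open horizontal rhombus (`root`), a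
non-convex dart, and a right triangle (`tri`). In each of them the largest rhombus of the prescribed
orientation is unique (`size_le_and_centre_eq`). It cuts the root into two mirror darts, a dart into
two mirror triangles, and a triangle into a triangle scaled by `a` (`tipMap`, which exchanges the
orientations) and a dart scaled by `(1 - a ^ 2) / 2` (`sideMap`); see `base_diff_inscribed`. The
construction is therefore a graph-directed iterated function system: the regions after `k` steps are
indexed by binary words of length `k` (`mem_emptyRegions_iff`), and their diameters tend to zero
uniformly (`exists_isSim_root`).

Any family of closed sets, one inside each shape, that contains the corners and satisfies the
self-similarity relations (`IsLimitFamily`) has the gasket as its root member, because every small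
region contains a point of it. Every small region also contains a contact point in its closure, so
contact points are dense in the gasket. Conversely, two rhombi of opposite orientations can meet
only in points of such a family: peel off the common part of their addresses, and keep track, by
parity, of which boundary edges belong to which orientation (`rhombusAt_inter_rhombusAt`). Both
claims about the gasket thus reduce to constructing one family.

That family consists of images of curves. The two subregions of a dart or a triangle meet in a
single point, so a curve through the triangle from `(0, 1)` to `(a, 0)` can be refined by joining a
copy through the tip to a copy through the dart; a dart curve is a triangle curve followed by its
reversed mirror image, and the closed root curve arises from the dart curve likewise. Refinement
contracts the sup distance by `max a (halfHeight a) < 1`, uniformly for `a` in compact subintervals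
of `(0, 1)`, so the polygons converge to a jointly continuous limit. For injectivity, if equal
values of the limit force parameters within `ε`, self-similarity improves this to `ε / 2`; iterating
gives `0`. -/

/-- The other orientation. -/
def Orientation.opp : Orientation → Orientation
  | .horizontal => .vertical
  | .vertical => .horizontal

lemma Orientation.opp_opp (o : Orientation) : o.opp.opp = o := by cases o <;> rfl

lemma orientationAt_succ (k : ℕ) : orientationAt (k + 1) = (orientationAt k).opp := by
  unfold orientationAt
  by_cases h : Odd k
  · simp [Nat.odd_add_one, h, Orientation.opp]
  · simp [Nat.odd_add_one, h, Orientation.opp]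

/-! ### Coordinates in the plane -/

lemma plane_ext {p q : Plane} (h0 : p 0 = q 0) (h1 : p 1 = q 1) : p = q := by
  ext i; fin_cases i <;> assumption

lemma dist_eq_sqrt (p q : Plane) :
    dist p q = √((p 0 - q 0) ^ 2 + (p 1 - q 1) ^ 2) := by
  simp [EuclideanSpace.dist_eq, Fin.sum_univ_two, Real.dist_eq, sq_abs]

lemma dist_le_of_abs {p q : Plane} {A : ℝ} (h0 : |p 0 - q 0| ≤ A) (h1 : |p 1 - q 1| ≤ A) :
    dist p q ≤ 2 * A := by
  have hA : 0 ≤ A := (abs_nonneg _).trans h0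
  rw [dist_eq_sqrt]
  apply Real.sqrt_le_iff.2
  refine ⟨by positivity, ?_⟩
  rw [← sq_abs (p 0 - q 0), ← sq_abs (p 1 - q 1)]
  nlinarith [abs_nonneg (p 0 - q 0), abs_nonneg (p 1 - q 1)]

lemma continuous_mk {X : Type*} [TopologicalSpace X] {u v : X → ℝ} (hu : Continuous u)
    (hv : Continuous v) : Continuous fun x => (!₂[u x, v x] : Plane) := by
  refine (PiLp.continuous_toLp 2 _).comp (continuous_pi fun i => ?_)
  fin_cases i
  · exact hu
  · exact hv

/-! ### Similarities respecting the rhombi -/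

/-- `φ` is a similarity of ratio `r` mapping rhombi of orientation `o` to rhombi of
orientation `σ o`. -/
structure IsSim (a r : ℝ) (σ : Orientation → Orientation) (φ : Plane → Plane) : Prop where
  pos : 0 < r
  surj : Function.Surjective φ
  dist_map : ∀ p q, dist (φ p) (φ q) = r * dist p q
  opp : ∀ o, σ o.opp = (σ o).opp
  mem_iff : ∀ o c s p, φ p ∈ rhombus a (σ o) (φ c) (r * s) ↔ p ∈ rhombus a o c s

namespace IsSim

variable {a r r' : ℝ} {σ σ' : Orientation → Orientation} {φ ψ : Plane → Plane}

lemma id (a : ℝ) : IsSim a 1 _root_.id _root_.id where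
  pos := one_pos
  surj := Function.surjective_id
  dist_map := by simp
  opp := fun _ => rfl
  mem_iff := by simp

lemma comp (h : IsSim a r σ φ) (h' : IsSim a r' σ' ψ) : IsSim a (r * r') (σ ∘ σ') (φ ∘ ψ) where
  pos := mul_pos h.pos h'.pos
  surj := h.surj.comp h'.surj
  dist_map p q := by simp [h.dist_map, h'.dist_map, mul_assoc]
  opp o := by simp [h.opp, h'.opp]
  mem_iff o c s p := by
    simp only [Function.comp, mul_assoc]
    rw [h.mem_iff, h'.mem_iff]

lemma injective (h : IsSim a r σ φ) : Function.Injective φ := fun p q e => by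
  have := h.dist_map p q
  rw [e, dist_self] at this
  exact dist_eq_zero.1 ((mul_eq_zero.1 this.symm).resolve_left h.pos.ne')

lemma image_rhombus (h : IsSim a r σ φ) (o : Orientation) (c : Plane) (s : ℝ) :
    φ '' rhombus a o c s = rhombus a (σ o) (φ c) (r * s) := by
  ext x
  obtain ⟨p, rfl⟩ := h.surj x
  rw [h.injective.mem_set_image, h.mem_iff]

lemma exists_homeomorph (h : IsSim a r σ φ) : ∃ e : Plane ≃ₜ Plane, ⇑e = φ := by
  have hr := h.pos
  let e := Equiv.ofBijective φ ⟨h.injective, h.surj⟩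
  have he : ∀ x, φ (e.symm x) = x := e.apply_symm_apply
  refine ⟨⟨e, ?_, ?_⟩, rfl⟩
  · refine (LipschitzWith.of_dist_le_mul (K := r.toNNReal) fun p q => ?_).continuous
    rw [Real.coe_toNNReal _ hr.le]
    exact (h.dist_map p q).le
  · refine (LipschitzWith.of_dist_le_mul (K := r⁻¹.toNNReal) fun p q => ?_).continuous
    rw [Real.coe_toNNReal _ (by positivity)]
    have := h.dist_map (e.symm p) (e.symm q)
    rw [he, he] at this
    rw [this, ← mul_assoc, inv_mul_cancel₀ hr.ne', one_mul]
    exact le_rfl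

lemma continuous (h : IsSim a r σ φ) : Continuous φ := by
  obtain ⟨e, rfl⟩ := h.exists_homeomorph; exact e.continuous

lemma image_closure (h : IsSim a r σ φ) (S : Set Plane) : closure (φ '' S) = φ '' closure S := by
  obtain ⟨e, rfl⟩ := h.exists_homeomorph; exact (e.image_closure S).symm

lemma image_frontier (h : IsSim a r σ φ) (S : Set Plane) :
    frontier (φ '' S) = φ '' frontier S := by
  obtain ⟨e, rfl⟩ := h.exists_homeomorph; exact (e.image_frontier S).symm

lemma isOpen_image (h : IsSim a r σ φ) {S : Set Plane} (hS : IsOpen S) : IsOpen (φ '' S) := by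
  obtain ⟨e, rfl⟩ := h.exists_homeomorph; exact e.isOpenMap _ hS

/-- Transport of a unique largest rhombus along a similarity. -/
lemma isLargestRhombus_image_iff (h : IsSim a r σ φ) {o : Orientation} {E : Set Plane}
    {c : Plane} {s : ℝ} (hs : 0 < s) (hE : rhombus a o c s ⊆ E)
    (hmax : ∀ c' s', rhombus a o c' s' ⊆ E → s' ≤ s)
    (huniq : ∀ c', rhombus a o c' s ⊆ E → c' = c) (R : Set Plane) :
    IsLargestRhombus a (σ o) (φ '' E) R ↔ R = φ '' rhombus a o c s := by
  have hr := h.pos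
  have key : ∀ c' s', rhombus a (σ o) (φ c') s' ⊆ φ '' E → rhombus a o c' (s' / r) ⊆ E := by
    intro c' s' hsub
    rw [← image_subset_image_iff h.injective, h.image_rhombus, mul_div_cancel₀ _ hr.ne']
    exact hsub
  constructor
  · rintro ⟨c', s', hs', rfl, hsub, hle⟩
    obtain ⟨c', rfl⟩ := h.surj c'
    have h1 := key _ _ hsub
    have h2 := hmax _ _ h1
    have h3 := hle (φ c) (r * s) (by rw [← h.image_rhombus]; exact image_mono hE)
    have h4 : s' / r = s := by
      refine le_antisymm h2 ?_
      rw [le_div_iff₀ hr, mul_comm]; exact h3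
    rw [h4] at h1
    rw [huniq _ h1, h.image_rhombus, ← h4, mul_div_cancel₀ _ hr.ne']
  · rintro rfl
    refine ⟨φ c, r * s, mul_pos hr hs, h.image_rhombus _ _ _, image_mono hE, ?_⟩
    intro c' s' hsub
    obtain ⟨c', rfl⟩ := h.surj c'
    have := hmax _ _ (key _ _ hsub)
    rwa [div_le_iff₀ hr, mul_comm] at this

lemma of_coords (hr : 0 < r) (hs : Function.Surjective φ) (hopp : ∀ o, σ o.opp = (σ o).opp)
    (hd : ∀ p q, (φ p 0 - φ q 0) ^ 2 + (φ p 1 - φ q 1) ^ 2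
      = r ^ 2 * ((p 0 - q 0) ^ 2 + (p 1 - q 1) ^ 2))
    (hmem : ∀ o c s p, φ p ∈ rhombus a (σ o) (φ c) (r * s) ↔ p ∈ rhombus a o c s) :
    IsSim a r σ φ where
  pos := hr
  surj := hs
  opp := hopp
  mem_iff := hmem
  dist_map p q := by
    rw [dist_eq_sqrt, dist_eq_sqrt, hd, Real.sqrt_mul (by positivity), Real.sqrt_sq hr.le]

end IsSim

/-- Half the height of the rhombus inscribed in the standard triangle. -/
def halfHeight (a : ℝ) : ℝ := (1 - a ^ 2) / 2

lemma halfHeight_pos {a : ℝ} (ha : a ∈ Ioo (0 : ℝ) 1) : 0 < halfHeight a := by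
  unfold halfHeight; nlinarith [ha.1, ha.2]

/-- Reflection in the vertical axis. -/
def flipX (p : Plane) : Plane := !₂[-p 0, p 1]

/-- Reflection in the horizontal axis. -/
def flipY (p : Plane) : Plane := !₂[p 0, -p 1]

/-- The similarity from the standard triangle to its subtriangle at the thin tip. -/
def tipMap (a : ℝ) (p : Plane) : Plane := !₂[a * (1 - p 1), 1 - a * p 0]

/-- The similarity from the standard dart to the dart inside the standard triangle. -/
def sideMap (a : ℝ) (p : Plane) : Plane :=
  !₂[a + halfHeight a * p 0, halfHeight a + halfHeight a * p 1]

@[simp] lemma flipX_zero (p : Plane) : flipX p 0 = -p 0 := rfl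
@[simp] lemma flipX_one (p : Plane) : flipX p 1 = p 1 := rfl
@[simp] lemma flipY_zero (p : Plane) : flipY p 0 = p 0 := rfl
@[simp] lemma flipY_one (p : Plane) : flipY p 1 = -p 1 := rfl
@[simp] lemma tipMap_zero (a : ℝ) (p : Plane) : tipMap a p 0 = a * (1 - p 1) := rfl
@[simp] lemma tipMap_one (a : ℝ) (p : Plane) : tipMap a p 1 = 1 - a * p 0 := rfl
@[simp] lemma sideMap_zero (a : ℝ) (p : Plane) : sideMap a p 0 = a + halfHeight a * p 0 := rfl
@[simp] lemma sideMap_one (a : ℝ) (p : Plane) :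
    sideMap a p 1 = halfHeight a + halfHeight a * p 1 := rfl

lemma flipX_flipX (p : Plane) : flipX (flipX p) = p := plane_ext (by simp) (by simp)
lemma flipY_flipY (p : Plane) : flipY (flipY p) = p := plane_ext (by simp) (by simp)

lemma abs_neg_sub_neg (x y : ℝ) : |-x - -y| = |x - y| := by
  rw [← abs_neg]; congr 1; ring

lemma isSim_flipX (a : ℝ) : IsSim a 1 id flipX := by
  refine .of_coords one_pos (fun p => ⟨flipX p, flipX_flipX p⟩) (fun _ => rfl) ?_ ?_
  · intro p q; simp; ring
  · intro o c s p
    cases o <;> simp only [rhombus, id, mem_ofPred_eq, flipX_zero, flipX_one, abs_neg_sub_neg,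
      one_mul]

lemma isSim_flipY (a : ℝ) : IsSim a 1 id flipY := by
  refine .of_coords one_pos (fun p => ⟨flipY p, flipY_flipY p⟩) (fun _ => rfl) ?_ ?_
  · intro p q; simp; ring
  · intro o c s p
    cases o <;> simp only [rhombus, id, mem_ofPred_eq, flipY_zero, flipY_one, abs_neg_sub_neg,
      one_mul]

/-- The linear part of `tipMap` interchanges the coordinate axes, hence also the horizontal and
vertical rhombi. This is why the triangle inside a triangle correctly expects a rhombus of the other
orientation at the next iteration. -/
lemma isSim_tipMap {a : ℝ} (ha : a ∈ Ioo (0 : ℝ) 1) : IsSim a a Orientation.opp (tipMap a) := by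
  have h0 := ha.1
  refine .of_coords h0 (fun p => ⟨!₂[(1 - p 1) / a, 1 - p 0 / a], plane_ext ?_ ?_⟩)
    (fun _ => rfl) ?_ ?_
  · simp; field_simp
  · simp; field_simp; ring
  · intro p q; simp; ring
  · intro o c s p
    have e0 : a * (1 - p 1) - a * (1 - c 1) = a * (c 1 - p 1) := by ring
    have e1 : 1 - a * p 0 - (1 - a * c 0) = a * (c 0 - p 0) := by ring
    cases o <;> simp only [rhombus, Orientation.opp, mem_ofPred_eq, tipMap_zero, tipMap_one, e0, e1,
      abs_mul, abs_of_pos h0, abs_sub_comm (c 0), abs_sub_comm (c 1)]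
    · rw [show a * |p 1 - c 1| + a * (a * |p 0 - c 0|) = a * (a * |p 0 - c 0| + |p 1 - c 1|) by ring,
        mul_le_mul_iff_right₀ h0]
    · rw [show a * (a * |p 1 - c 1|) + a * |p 0 - c 0| = a * (|p 0 - c 0| + a * |p 1 - c 1|) by ring,
        mul_le_mul_iff_right₀ h0]

lemma isSim_sideMap {a : ℝ} (ha : a ∈ Ioo (0 : ℝ) 1) :
    IsSim a (halfHeight a) id (sideMap a) := by
  have h0 := halfHeight_pos ha
  refine .of_coords h0
    (fun p => ⟨!₂[(p 0 - a) / halfHeight a, p 1 / halfHeight a - 1], plane_ext ?_ ?_⟩)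
    (fun _ => rfl) ?_ ?_
  · simp; field_simp; ring
  · simp; field_simp; ring
  · intro p q; simp; ring
  · intro o c s p
    have e0 : a + halfHeight a * p 0 - (a + halfHeight a * c 0) = halfHeight a * (p 0 - c 0) := by
      ring
    have e1 : halfHeight a + halfHeight a * p 1 - (halfHeight a + halfHeight a * c 1)
      = halfHeight a * (p 1 - c 1) := by ring
    cases o <;> simp only [rhombus, id, mem_ofPred_eq, sideMap_zero, sideMap_one, e0, e1,
      abs_mul, abs_of_pos h0]
    · rw [show a * (halfHeight a * |p 0 - c 0|) + halfHeight a * |p 1 - c 1|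
        = halfHeight a * (a * |p 0 - c 0| + |p 1 - c 1|) by ring, mul_left_comm,
        mul_le_mul_iff_right₀ h0]
    · rw [show halfHeight a * |p 0 - c 0| + a * (halfHeight a * |p 1 - c 1|)
        = halfHeight a * (|p 0 - c 0| + a * |p 1 - c 1|) by ring, mul_left_comm,
        mul_le_mul_iff_right₀ h0]

/-! ### The three shapes -/

/-- The shapes of the empty regions, up to similarity. -/
inductive Shape where
  | root
  | dart
  | tri

namespace Shape

/-- The orientation of the rhombus placed into the standard copy of a shape. -/
def orient : Shape → Orientation
  | root => .vertical
  | dart => .horizontal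
  | tri => .vertical

/-- The standard open copy of a shape. -/
def base (a : ℝ) : Shape → Set Plane
  | root => {p | a * |p 0| + |p 1| < 1}
  | dart => {p | a * p 0 + |p 1| < 1 ∧ a < p 0 + a * |p 1|}
  | tri => {p | a * p 0 + p 1 < 1 ∧ a < p 0 + a * p 1 ∧ a * p 0 - p 1 < a ^ 2}

/-- The standard closed copy of a shape. -/
def region (a : ℝ) : Shape → Set Plane
  | root => {p | a * |p 0| + |p 1| ≤ 1}
  | dart => {p | a * p 0 + |p 1| ≤ 1 ∧ a ≤ p 0 + a * |p 1|}
  | tri => {p | a * p 0 + p 1 ≤ 1 ∧ a ≤ p 0 + a * p 1 ∧ a * p 0 - p 1 ≤ a ^ 2}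

/-- The centre of the largest rhombus in a standard shape. -/
def centre (a : ℝ) : Shape → Plane
  | root => !₂[0, 0]
  | dart => !₂[(a + 1 / a) / 2, 0]
  | tri => !₂[a, halfHeight a]

/-- The size of the largest rhombus in a standard shape. -/
def size (a : ℝ) : Shape → ℝ
  | root => 1
  | dart => halfHeight a / a
  | tri => halfHeight a

/-- The largest rhombus in a standard shape. -/
def inscribed (a : ℝ) (t : Shape) : Set Plane := rhombus a t.orient (t.centre a) (t.size a)

/-- The part of the boundary that belongs to rhombi of the orientation to be placed next. -/
def sameEdges (a : ℝ) : Shape → Set Plane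
  | root => ∅
  | dart => {p | p ∈ region a dart ∧ a * p 0 + |p 1| = 1}
  | tri => {p | p ∈ region a tri ∧ p 0 + a * p 1 = a}

/-- The part of the boundary that belongs to rhombi of the other orientation. -/
def oppEdges (a : ℝ) : Shape → Set Plane
  | root => {p | a * |p 0| + |p 1| = 1}
  | dart => {p | p ∈ region a dart ∧ p 0 + a * |p 1| = a}
  | tri => {p | p ∈ region a tri ∧ (a * p 0 + p 1 = 1 ∨ a * p 0 - p 1 = a ^ 2)}

/-- The two subregions left after placing the inscribed rhombus: their shapes. -/
def next : Shape → Bool → Shape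
  | root, _ => dart
  | dart, _ => tri
  | tri, false => tri
  | tri, true => dart

/-- The two subregions left after placing the inscribed rhombus: their positions. -/
def nextMap (a : ℝ) : Shape → Bool → Plane → Plane
  | root, false => id
  | root, true => flipX
  | dart, false => id
  | dart, true => flipY
  | tri, false => tipMap a
  | tri, true => sideMap a

/-- The contact point at which the inscribed rhombus separates the two subregions. -/
def mid (a : ℝ) : Shape → Plane
  | root => !₂[0, 1]
  | dart => !₂[a, 0]
  | tri => !₂[a, 1 - a ^ 2]

variable {a : ℝ}

lemma base_subset_region (t : Shape) : t.base a ⊆ t.region a := by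
  cases t
  · exact fun p hp => le_of_lt (α := ℝ) hp
  · exact fun p hp => ⟨hp.1.le, hp.2.le⟩
  · exact fun p hp => ⟨hp.1.le, hp.2.1.le, hp.2.2.le⟩

lemma isOpen_base (t : Shape) : IsOpen (t.base a) := by
  cases t
  · exact isOpen_lt (by fun_prop) (by fun_prop)
  · refine IsOpen.and (isOpen_lt ?_ ?_) (isOpen_lt ?_ ?_) <;> fun_prop
  · refine IsOpen.and (isOpen_lt ?_ ?_) (IsOpen.and (isOpen_lt ?_ ?_) (isOpen_lt ?_ ?_)) <;>
      fun_prop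

lemma isClosed_region (t : Shape) : IsClosed (t.region a) := by
  cases t
  · exact isClosed_le (by fun_prop) (by fun_prop)
  · refine IsClosed.and (isClosed_le ?_ ?_) (isClosed_le ?_ ?_) <;> fun_prop
  · refine IsClosed.and (isClosed_le ?_ ?_) (IsClosed.and (isClosed_le ?_ ?_) (isClosed_le ?_ ?_)) <;>
      fun_prop

/-! ### Closures of the standard shapes. -/

lemma mem_closure_of_segment {S : Set Plane} {p z : Plane}
    (h : ∀ e ∈ Ioo (0 : ℝ) 1, (!₂[(1 - e) * p 0 + e * z 0, (1 - e) * p 1 + e * z 1] : Plane) ∈ S) :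
    p ∈ closure S := by
  have hc : Continuous fun e : ℝ =>
      (!₂[(1 - e) * p 0 + e * z 0, (1 - e) * p 1 + e * z 1] : Plane) :=
    continuous_mk (by fun_prop) (by fun_prop)
  have ht := (hc.tendsto 0).mono_left (nhdsWithin_le_nhds (s := Ioi (0 : ℝ)))
  have e0 : (!₂[(1 - 0) * p 0 + 0 * z 0, (1 - 0) * p 1 + 0 * z 1] : Plane) = p :=
    plane_ext (by simp) (by simp)
  rw [e0] at ht
  refine mem_closure_of_tendsto ht ?_
  filter_upwards [Ioo_mem_nhdsGT (zero_lt_one (α := ℝ))] with e he using h e he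

/-- Each shape is star-shaped about the centre of its inscribed rhombus: moving a boundary point
slightly towards that centre makes all the weak inequalities strict. -/
lemma closure_base (ha : a ∈ Ioo (0 : ℝ) 1) (t : Shape) : closure (t.base a) = t.region a := by
  refine (closure_minimal (base_subset_region t) (isClosed_region t)).antisymm fun p hp => ?_
  obtain ⟨ha0, ha1⟩ := ha
  cases t
  · refine mem_closure_of_segment (z := !₂[0, 0]) fun e he => ?_
    simp only [base, region, mem_ofPred_eq] at hp ⊢
    have hE : 0 < 1 - e := by linarith [he.2]
    simp only [Matrix.cons_val_zero, Matrix.cons_val_one, mul_zero, add_zero,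
      abs_mul, abs_of_pos hE]
    nlinarith [he.1]
  · refine mem_closure_of_segment (z := !₂[(a + 1 / a) / 2, 0]) fun e he => ?_
    simp only [base, region, mem_ofPred_eq] at hp ⊢
    have hE : 0 < 1 - e := by linarith [he.2]
    simp only [Matrix.cons_val_zero, Matrix.cons_val_one, mul_zero, add_zero,
      abs_mul, abs_of_pos hE]
    have hc : a * ((a + 1 / a) / 2) < 1 := by field_simp; nlinarith
    have hc' : a < (a + 1 / a) / 2 := by
      rw [lt_div_iff₀ two_pos]; have : 1 < 1 / a := by rw [lt_div_iff₀ ha0]; linarith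
      linarith
    obtain ⟨h1, h2⟩ := hp
    constructor
    · nlinarith [mul_le_mul_of_nonneg_left h1 hE.le, mul_lt_mul_of_pos_left hc he.1]
    · nlinarith [mul_le_mul_of_nonneg_left h2 hE.le, mul_lt_mul_of_pos_left hc' he.1]
  · refine mem_closure_of_segment (z := !₂[a, halfHeight a]) fun e he => ?_
    simp only [base, region, mem_ofPred_eq, halfHeight] at hp ⊢
    have hE : 0 < 1 - e := by linarith [he.2]
    simp only [Matrix.cons_val_zero, Matrix.cons_val_one]
    obtain ⟨h1, h2, h3⟩ := hp
    have hh : 0 < (1 - a ^ 2) / 2 := by nlinarith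
    have := mul_pos he.1 hh
    refine ⟨?_, ?_, ?_⟩
    · nlinarith [mul_le_mul_of_nonneg_left h1 hE.le]
    · nlinarith [mul_le_mul_of_nonneg_left h2 hE.le, mul_pos ha0 this]
    · nlinarith [mul_le_mul_of_nonneg_left h3 hE.le]

/-! ### The largest rhombus in each standard shape, and its uniqueness. -/

lemma size_pos (ha : a ∈ Ioo (0 : ℝ) 1) (t : Shape) : 0 < t.size a := by
  cases t
  · exact one_pos
  · exact div_pos (halfHeight_pos ha) ha.1
  · exact halfHeight_pos ha

lemma inscribed_subset (ha : a ∈ Ioo (0 : ℝ) 1) (t : Shape) : t.inscribed a ⊆ t.region a := by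
  obtain ⟨ha0, ha1⟩ := ha
  intro p hp
  cases t <;> simp only [inscribed, orient, rhombus, centre, size, region, mem_ofPred_eq,
    Matrix.cons_val_zero, Matrix.cons_val_one, sub_zero, mul_one, halfHeight] at *
  · have h1 : |p 1| ≤ 1 := by
      have := abs_nonneg (p 0)
      by_contra! h; nlinarith
    have h2 : 0 ≤ 1 - a ^ 2 := by nlinarith
    nlinarith [mul_le_mul_of_nonneg_left hp ha0.le, mul_le_mul_of_nonneg_left h1 h2]
  · rw [mul_div_cancel₀ _ ha0.ne'] at hp
    have e : a * ((a + 1 / a) / 2) = (a ^ 2 + 1) / 2 := by field_simp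
    have h1 := mul_le_mul_of_nonneg_left (le_abs_self (p 0 - (a + 1 / a) / 2)) ha0.le
    have h2 := mul_le_mul_of_nonneg_left (neg_le_abs (p 0 - (a + 1 / a) / 2)) ha0.le
    have h3 := abs_nonneg (p 1)
    refine ⟨by nlinarith, ?_⟩
    by_contra! h
    nlinarith
  · have h1 := le_abs_self (p 0 - a)
    have h2 := neg_le_abs (p 0 - a)
    have h3 := le_abs_self (p 1 - (1 - a ^ 2) / 2)
    have h4 := neg_le_abs (p 1 - (1 - a ^ 2) / 2)
    have h5 : a * |p 0 - a| + |p 1 - (1 - a ^ 2) / 2| ≤ (1 - a ^ 2) / 2 := by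
      have : a * (a * |p 0 - a|) ≤ |p 0 - a| := by
        have h2 : 0 ≤ 1 - a ^ 2 := by nlinarith
        nlinarith [mul_nonneg h2 (abs_nonneg (p 0 - a))]
      have : a * (a * |p 0 - a| + |p 1 - (1 - a ^ 2) / 2|) ≤ a * ((1 - a ^ 2) / 2) := by linarith
      exact le_of_mul_le_mul_left this ha0
    refine ⟨by nlinarith, by nlinarith, by nlinarith⟩

lemma vertex_mem_horizontal (a : ℝ) {c : Plane} {s : ℝ} (hs : 0 ≤ s) :
    (!₂[c 0 + s, c 1] : Plane) ∈ rhombus a .horizontal c s ∧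
    (!₂[c 0 - s, c 1] : Plane) ∈ rhombus a .horizontal c s := by
  constructor <;> simp [rhombus, abs_of_nonneg hs]

lemma vertex_mem_vertical (a : ℝ) {c : Plane} {s : ℝ} (hs : 0 ≤ s) :
    (!₂[c 0, c 1 + s] : Plane) ∈ rhombus a .vertical c s ∧
    (!₂[c 0, c 1 - s] : Plane) ∈ rhombus a .vertical c s := by
  constructor <;> simp [rhombus, abs_of_nonneg hs]

/-- The two ends of the long diagonal already decide everything: the inequalities of the shape at
these points bound the size, and equality in the bound makes them tight enough to determine the
centre. -/
lemma size_le_and_centre_eq (ha : a ∈ Ioo (0 : ℝ) 1) (t : Shape) {c : Plane} {s : ℝ} (hs : 0 ≤ s)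
    (h : rhombus a t.orient c s ⊆ t.region a) :
    s ≤ t.size a ∧ (s = t.size a → c = t.centre a) := by
  obtain ⟨ha0, ha1⟩ := ha
  have hh : 0 < 1 - a ^ 2 := by nlinarith
  cases t
  · obtain ⟨h1, h2⟩ := vertex_mem_vertical a (c := c) hs
    replace h1 := h h1
    replace h2 := h h2
    simp only [region, mem_ofPred_eq, Matrix.cons_val_zero, Matrix.cons_val_one,
      size, centre] at *
    have h3 := le_abs_self (c 1 + s)
    have h4 := neg_le_abs (c 1 - s)
    have h5 := mul_nonneg ha0.le (abs_nonneg (c 0))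
    refine ⟨by linarith, ?_⟩
    rintro rfl
    refine plane_ext ?_ ?_
    · have : a * |c 0| = 0 := by linarith
      simpa [ha0.ne'] using this
    · have : c 1 = 0 := by linarith
      simpa using this
  · obtain ⟨h1, h2⟩ := vertex_mem_horizontal a (c := c) hs
    replace h1 := (h h1).1
    replace h2 := (h h2).2
    simp only [Matrix.cons_val_zero, Matrix.cons_val_one,
      size, centre, halfHeight] at *
    have h3 := mul_le_mul_of_nonneg_left h2 ha0.le
    have h5 := abs_nonneg (c 1)
    have h4 := mul_nonneg hh.le h5
    rw [le_div_iff₀ ha0]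
    refine ⟨by nlinarith, fun hs => ?_⟩
    have hs' : a * s = (1 - a ^ 2) / 2 := by rw [hs]; field_simp
    have h6 : (1 - a ^ 2) * |c 1| = 0 := by nlinarith
    have h7 : |c 1| = 0 := (mul_eq_zero.1 h6).resolve_left hh.ne'
    rw [h7] at h1 h3
    refine plane_ext ?_ ?_
    · have : a * c 0 = (a ^ 2 + 1) / 2 := by nlinarith
      simp only [Matrix.cons_val_zero]
      field_simp
      linarith
    · simpa using h7
  · obtain ⟨h1, h2⟩ := vertex_mem_vertical a (c := c) hs
    replace h1 := (h h1).1
    replace h3 := (h h2).2.2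
    replace h2 := (h h2).2.1
    simp only [Matrix.cons_val_zero, Matrix.cons_val_one,
      size, centre, halfHeight] at *
    -- `h1` and `h2` are combined to eliminate the height `c 1`; adding `h1` and `h3` bounds `2 * a
    -- * c 0 + 2 * s` by `1 + a ^ 2`, and together these eliminate `c 0`.
    have h4 : 2 * a * s ≤ c 0 * (1 - a ^ 2) := by nlinarith
    have h5 : 2 * s * (1 + a ^ 2) ≤ (1 - a ^ 2) * (1 + a ^ 2) := by nlinarith
    have h6 : 2 * s ≤ 1 - a ^ 2 := le_of_mul_le_mul_right h5 (by positivity)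
    refine ⟨by linarith, ?_⟩
    rintro rfl
    have h7 : a * (1 - a ^ 2) ≤ c 0 * (1 - a ^ 2) := by linarith
    have h8 : a ≤ c 0 := le_of_mul_le_mul_right h7 hh
    have h9 : a * c 0 ≤ a * a := by nlinarith
    have h10 : c 0 ≤ a := le_of_mul_le_mul_left h9 ha0
    have h11 : c 0 = a := le_antisymm h10 h8
    rw [h11] at h1 h2
    refine plane_ext h11 ?_
    have h12 : a * ((1 - a ^ 2) / 2) ≤ a * c 1 := by linarith
    have h13 := le_of_mul_le_mul_left h12 ha0
    change c 1 = halfHeight a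
    unfold halfHeight
    nlinarith

/-! ### Connectedness of the standard shapes. -/

lemma isPreconnected_base (ha : a ∈ Ioo (0 : ℝ) 1) (t : Shape) :
    IsPreconnected (t.base a) := by
  have hlin : ∀ u v w : ℝ, Convex ℝ {p : Plane | u * p 0 + v * p 1 < w} := by
    intro u v w p hp q hq x y hx hy hxy
    simp only [mem_ofPred_eq, PiLp.add_apply, PiLp.smul_apply, smul_eq_mul] at *
    have : u * (x * p 0 + y * q 0) + v * (x * p 1 + y * q 1)
      = x * (u * p 0 + v * p 1) + y * (u * q 0 + v * q 1) := by ring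
    rw [this]
    have hx' : x = 1 - y := by linarith
    subst hx'
    rcases hx.eq_or_lt with h | h
    · have : y = 1 := by linarith
      subst this; simpa using hq
    · nlinarith [mul_lt_mul_of_pos_left hp h, mul_le_mul_of_nonneg_left (le_of_lt hq) hy]
  obtain ⟨ha0, ha1⟩ := ha
  cases t
  · have : base a root =
        {p : Plane | a * p 0 + 1 * p 1 < 1} ∩ {p : Plane | (-a) * p 0 + 1 * p 1 < 1} ∩
        ({p : Plane | a * p 0 + (-1) * p 1 < 1} ∩ {p : Plane | (-a) * p 0 + (-1) * p 1 < 1}) := by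
      ext p
      simp only [base, mem_inter_iff, mem_ofPred_eq]
      rcases abs_cases (p 0) with ⟨e, h⟩ | ⟨e, h⟩ <;>
        rcases abs_cases (p 1) with ⟨e', h'⟩ | ⟨e', h'⟩ <;> rw [e, e'] <;>
      constructor <;> intro H
      all_goals first | (refine ⟨⟨?_, ?_⟩, ?_, ?_⟩ <;> nlinarith) | nlinarith
    rw [this]
    exact (((hlin _ _ _).inter (hlin _ _ _)).inter ((hlin _ _ _).inter (hlin _ _ _))).isPreconnected
  -- The dart has a reflex corner at `(a, 0)`, so it is written as a union of two convex pieces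
  -- which share the centre of its inscribed rhombus.
  · let A := {p : Plane | a * p 0 + 1 * p 1 < 1} ∩ {p : Plane | a * p 0 + (-1) * p 1 < 1}
    have hA : Convex ℝ A := (hlin _ _ _).inter (hlin _ _ _)
    have : base a dart = A ∩ {p : Plane | (-1) * p 0 + (-a) * p 1 < -a} ∪
        A ∩ {p : Plane | (-1) * p 0 + a * p 1 < -a} := by
      ext p
      simp only [A, base, mem_inter_iff, mem_union, mem_ofPred_eq]
      rcases abs_cases (p 1) with ⟨e', h'⟩ | ⟨e', h'⟩ <;> rw [e'] <;> constructor
      · exact fun H => Or.inl ⟨⟨by linarith, by linarith⟩, by linarith⟩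
      · rintro (H | H) <;> exact ⟨by linarith, by nlinarith⟩
      · exact fun H => Or.inr ⟨⟨by linarith, by linarith⟩, by linarith⟩
      · rintro (H | H) <;> exact ⟨by linarith, by nlinarith⟩
    rw [this]
    have hc : a * ((a + 1 / a) / 2) < 1 := by field_simp; nlinarith
    have hc' : a < (a + 1 / a) / 2 := by
      rw [lt_div_iff₀ two_pos]; have : 1 < 1 / a := by rw [lt_div_iff₀ ha0]; linarith
      linarith
    refine IsPreconnected.union !₂[(a + 1 / a) / 2, 0] ?_ ?_ (hA.inter (hlin _ _ _)).isPreconnected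
      (hA.inter (hlin _ _ _)).isPreconnected
    · simp only [A, mem_inter_iff, mem_ofPred_eq, Matrix.cons_val_zero,
        Matrix.cons_val_one]
      refine ⟨⟨?_, ?_⟩, ?_⟩ <;> linarith
    · simp only [A, mem_inter_iff, mem_ofPred_eq, Matrix.cons_val_zero,
        Matrix.cons_val_one]
      refine ⟨⟨?_, ?_⟩, ?_⟩ <;> linarith
  · have : base a tri = {p : Plane | a * p 0 + 1 * p 1 < 1} ∩
        ({p : Plane | (-1) * p 0 + (-a) * p 1 < -a} ∩
        {p : Plane | a * p 0 + (-1) * p 1 < a ^ 2}) := by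
      ext p
      simp only [base, mem_inter_iff, mem_ofPred_eq]
      refine ⟨fun ⟨h1, h2, h3⟩ => ⟨?_, ?_, ?_⟩, fun ⟨h1, h2, h3⟩ => ⟨?_, ?_, ?_⟩⟩ <;> linarith
    rw [this]
    exact ((hlin _ _ _).inter ((hlin _ _ _).inter (hlin _ _ _))).isPreconnected

lemma base_nonempty (ha : a ∈ Ioo (0 : ℝ) 1) (t : Shape) : (t.base a).Nonempty := by
  rw [← closure_nonempty_iff, closure_base ha]
  refine ⟨t.centre a, inscribed_subset ha t ?_⟩
  have := mul_pos ha.1 (size_pos ha t)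
  cases h : t.orient <;> simp [inscribed, rhombus, h] <;> linarith

end Shape

/-! ### Frontiers of rhombi -/

/-- Dilating about `c` by `1 + e` turns a point with equality into one outside the set, since `ρ >
0`; hence points with equality are not interior. No sign is needed for the weights. -/
lemma frontier_interior_of_weighted {u v ρ : ℝ} (hρ : 0 < ρ) (c : Plane) :
    frontier {p : Plane | u * |p 0 - c 0| + v * |p 1 - c 1| ≤ ρ} =
      {p | u * |p 0 - c 0| + v * |p 1 - c 1| = ρ} ∧
    interior {p : Plane | u * |p 0 - c 0| + v * |p 1 - c 1| ≤ ρ} =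
      {p | u * |p 0 - c 0| + v * |p 1 - c 1| < ρ} := by
  have hcl : IsClosed {p : Plane | u * |p 0 - c 0| + v * |p 1 - c 1| ≤ ρ} :=
    isClosed_le (by fun_prop) (by fun_prop)
  have hint : interior {p : Plane | u * |p 0 - c 0| + v * |p 1 - c 1| ≤ ρ} =
      {p | u * |p 0 - c 0| + v * |p 1 - c 1| < ρ} := by
    refine Subset.antisymm (fun p hp => ?_) (interior_maximal (fun p hp => le_of_lt (α := ℝ) hp)
      (isOpen_lt (by fun_prop) (by fun_prop)))
    have hle : p ∈ {p : Plane | u * |p 0 - c 0| + v * |p 1 - c 1| ≤ ρ} := interior_subset hp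
    refine lt_of_le_of_ne (α := ℝ) hle fun he => ?_
    have hc : Continuous fun e : ℝ =>
        (!₂[p 0 + e * (p 0 - c 0), p 1 + e * (p 1 - c 1)] : Plane) :=
      continuous_mk (by fun_prop) (by fun_prop)
    have ht := (hc.tendsto 0).mono_left (nhdsWithin_le_nhds (s := Ioi (0 : ℝ)))
    have e0 : (!₂[p 0 + 0 * (p 0 - c 0), p 1 + 0 * (p 1 - c 1)] : Plane) = p :=
      plane_ext (by simp) (by simp)
    rw [e0] at ht
    obtain ⟨e, he1, he2⟩ :=
      ((ht.eventually (mem_interior_iff_mem_nhds.1 hp)).and self_mem_nhdsWithin).exists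
    have he2 : 0 < e := he2
    simp only [Matrix.cons_val_zero, Matrix.cons_val_one] at he1
    have x0 : p 0 + e * (p 0 - c 0) - c 0 = (1 + e) * (p 0 - c 0) := by ring
    have x1 : p 1 + e * (p 1 - c 1) - c 1 = (1 + e) * (p 1 - c 1) := by ring
    rw [x0, x1, abs_mul, abs_mul, abs_of_pos (by linarith : 0 < 1 + e)] at he1
    nlinarith
  refine ⟨?_, hint⟩
  rw [hcl.frontier_eq, hint]
  ext p
  simp only [Set.mem_sdiff, mem_ofPred_eq, not_lt]
  exact ⟨fun h => le_antisymm h.1 h.2, fun h => ⟨h.le, h.ge⟩⟩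

lemma frontier_rhombus_horizontal {a s : ℝ} (ha : 0 < a) (hs : 0 < s) (c : Plane) :
    frontier (rhombus a .horizontal c s) = {p | a * |p 0 - c 0| + |p 1 - c 1| = a * s} := by
  have := (frontier_interior_of_weighted (u := a) (v := 1) (mul_pos ha hs) c).1
  simp only [one_mul] at this
  exact this

lemma frontier_rhombus_vertical {a s : ℝ} (ha : 0 < a) (hs : 0 < s) (c : Plane) :
    frontier (rhombus a .vertical c s) = {p | |p 0 - c 0| + a * |p 1 - c 1| = a * s} := by
  have := (frontier_interior_of_weighted (u := 1) (v := a) (mul_pos ha hs) c).1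
  simp only [one_mul] at this
  exact this

lemma isClosed_rhombus (a : ℝ) (o : Orientation) (c : Plane) (s : ℝ) :
    IsClosed (rhombus a o c s) := by
  cases o
  · exact isClosed_le (by fun_prop) (by fun_prop)
  · exact isClosed_le (by fun_prop) (by fun_prop)

lemma initialRhombus_eq {a : ℝ} (ha : 0 < a) : initialRhombus a = Shape.root.region a := by
  ext p
  simp [initialRhombus, rhombus, Shape.region, ha.ne']

lemma interior_initialRhombus {a : ℝ} (ha : 0 < a) :
    interior (initialRhombus a) = Shape.root.base a := by
  rw [initialRhombus_eq ha]
  simpa [Shape.region, Shape.base] using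
    (frontier_interior_of_weighted (u := a) (v := 1) one_pos (0 : Plane)).2

lemma frontier_initialRhombus {a : ℝ} (ha : 0 < a) :
    frontier (initialRhombus a) = Shape.root.oppEdges a := by
  rw [initialRhombus_eq ha]
  simpa [Shape.region, Shape.oppEdges] using
    (frontier_interior_of_weighted (u := a) (v := 1) one_pos (0 : Plane)).1

namespace Shape

variable {a : ℝ}

/-! ### How a region splits -/

/-- These sign bounds, and those for the dart, serve to remove the absolute values when a subregion
is compared with its parent. -/
lemma tri_bounds (ha : a ∈ Ioo (0 : ℝ) 1) {p : Plane} (hp : p ∈ tri.region a) :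
    0 ≤ p 0 ∧ 0 ≤ p 1 ∧ p 1 ≤ 1 := by
  obtain ⟨ha0, ha1⟩ := ha
  obtain ⟨h1, h2, h3⟩ := hp
  have hh : 0 < 1 - a ^ 2 := by nlinarith
  have h0 : 0 ≤ p 0 := by
    have : 0 ≤ (1 - a ^ 2) * p 0 := by nlinarith
    exact nonneg_of_mul_nonneg_right this hh
  refine ⟨h0, ?_, by nlinarith⟩
  have : 0 ≤ (1 + a ^ 2) * p 1 := by nlinarith
  exact nonneg_of_mul_nonneg_right this (by positivity)

lemma dart_bounds (ha : a ∈ Ioo (0 : ℝ) 1) {p : Plane} (hp : p ∈ dart.region a) :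
    0 ≤ p 0 ∧ |p 1| ≤ 1 := by
  obtain ⟨ha0, ha1⟩ := ha
  obtain ⟨h1, h2⟩ := hp
  have hh : 0 < 1 - a ^ 2 := by nlinarith
  have h0 : 0 ≤ p 0 := by
    have : 0 ≤ (1 - a ^ 2) * p 0 := by nlinarith
    exact nonneg_of_mul_nonneg_right this hh
  exact ⟨h0, by nlinarith⟩

lemma mul_dart_centre (ha : 0 < a) : a * ((a + 1 / a) / 2) = (a ^ 2 + 1) / 2 := by field_simp

lemma mul_dart_abs (ha : 0 < a) (x : ℝ) :
    a * |x - (a + 1 / a) / 2| = |a * x - (a ^ 2 + 1) / 2| := by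
  rw [← mul_dart_centre ha, ← mul_sub, abs_mul, abs_of_pos ha]

lemma mem_inscribed_dart (ha : 0 < a) (p : Plane) :
    p ∈ dart.inscribed a ↔ |a * p 0 - (a ^ 2 + 1) / 2| + |p 1| ≤ halfHeight a := by
  simp only [inscribed, orient, rhombus, centre, size, mem_ofPred_eq, Matrix.cons_val_zero,
    Matrix.cons_val_one, sub_zero, mul_dart_abs ha, mul_div_cancel₀ _ ha.ne']

lemma mem_frontier_inscribed_dart (ha : a ∈ Ioo (0 : ℝ) 1) (p : Plane) :
    p ∈ frontier (dart.inscribed a) ↔ |a * p 0 - (a ^ 2 + 1) / 2| + |p 1| = halfHeight a := by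
  simp only [inscribed, orient, frontier_rhombus_horizontal ha.1 (size_pos ha dart)]
  simp only [centre, size, mem_ofPred_eq, Matrix.cons_val_zero,
    Matrix.cons_val_one, sub_zero, mul_dart_abs ha.1, mul_div_cancel₀ _ ha.1.ne']

lemma mem_inscribed_tri (p : Plane) :
    p ∈ tri.inscribed a ↔ |p 0 - a| + a * |p 1 - halfHeight a| ≤ a * halfHeight a := Iff.rfl

lemma mem_frontier_inscribed_tri (ha : a ∈ Ioo (0 : ℝ) 1) (p : Plane) :
    p ∈ frontier (tri.inscribed a) ↔
      |p 0 - a| + a * |p 1 - halfHeight a| = a * halfHeight a := by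
  simp only [inscribed, orient, frontier_rhombus_vertical ha.1 (size_pos ha tri)]
  rfl

lemma mem_inscribed_root (p : Plane) :
    p ∈ root.inscribed a ↔ |p 0| + a * |p 1| ≤ a := by
  simp [inscribed, orient, rhombus, centre, size]

lemma mem_frontier_inscribed_root (ha : a ∈ Ioo (0 : ℝ) 1) (p : Plane) :
    p ∈ frontier (root.inscribed a) ↔ |p 0| + a * |p 1| = a := by
  simp only [inscribed, orient, frontier_rhombus_vertical ha.1 (size_pos ha root)]
  simp [centre, size]

lemma nextMap_mem_region (ha : a ∈ Ioo (0 : ℝ) 1) (t : Shape) (b : Bool) {x : Plane}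
    (hx : x ∈ (t.next b).region a) : t.nextMap a b x ∈ t.region a := by
  have hh := halfHeight_pos ha
  have hd := fun h => dart_bounds ha (p := x) h
  have ht := fun h => tri_bounds ha (p := x) h
  obtain ⟨ha0, ha1⟩ := ha
  cases t <;> cases b <;> simp only [next, nextMap, id] at *
  · obtain ⟨h1, h2⟩ := hd hx
    simpa only [region, mem_ofPred_eq, abs_of_nonneg h1] using hx.1
  · obtain ⟨h1, h2⟩ := hd hx
    simpa only [region, mem_ofPred_eq, flipX_zero, abs_neg, flipX_one, abs_of_nonneg h1] using hx.1
  · obtain ⟨h1, h2, h3⟩ := ht hx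
    simpa only [region, mem_ofPred_eq, abs_of_nonneg h2] using ⟨hx.1, hx.2.1⟩
  · obtain ⟨h1, h2, h3⟩ := ht hx
    simpa only [region, mem_ofPred_eq, flipY_zero, abs_neg, flipY_one, abs_of_nonneg h2] using
      ⟨hx.1, hx.2.1⟩
  · obtain ⟨h1, h2, h3⟩ := ht hx
    obtain ⟨k1, k2, k3⟩ := hx
    refine ⟨?_, ?_, ?_⟩ <;> simp only [tipMap_zero, tipMap_one]
    · nlinarith
    · nlinarith
    · nlinarith [mul_nonneg ha0.le h1]
  · obtain ⟨h1, h2⟩ := hd hx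
    obtain ⟨k1, k2⟩ := hx
    have e : 2 * halfHeight a = 1 - a ^ 2 := by unfold halfHeight; ring
    have l1 := le_abs_self (x 1)
    have l2 := neg_le_abs (x 1)
    refine ⟨?_, ?_, ?_⟩ <;> simp only [sideMap_zero, sideMap_one]
    · nlinarith [mul_le_mul_of_nonneg_left k1 hh.le]
    · have : 0 ≤ 1 + x 1 := by linarith
      have := mul_nonneg ha0.le (mul_nonneg hh.le this)
      nlinarith [mul_nonneg hh.le h1]
    · nlinarith [mul_le_mul_of_nonneg_left k1 hh.le]

lemma mem_image_tipMap (ha : 0 < a) (S : Set Plane) (p : Plane) :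
    p ∈ tipMap a '' S ↔ (!₂[(1 - p 1) / a, 1 - p 0 / a] : Plane) ∈ S := by
  constructor
  · rintro ⟨x, hx, rfl⟩
    rwa [show (!₂[(1 - tipMap a x 1) / a, 1 - tipMap a x 0 / a] : Plane) = x from
      plane_ext (by simp; field_simp) (by simp; field_simp; ring)]
  · intro h
    refine ⟨_, h, plane_ext ?_ ?_⟩
    · simp; field_simp
    · simp; field_simp; ring

lemma mem_image_sideMap (ha : a ∈ Ioo (0 : ℝ) 1) (S : Set Plane) (p : Plane) :
    p ∈ sideMap a '' S ↔
      (!₂[(p 0 - a) / halfHeight a, p 1 / halfHeight a - 1] : Plane) ∈ S := by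
  have h0 := halfHeight_pos ha
  constructor
  · rintro ⟨x, hx, rfl⟩
    rwa [show (!₂[(sideMap a x 0 - a) / halfHeight a, sideMap a x 1 / halfHeight a - 1] : Plane) = x
      from plane_ext (by simp; field_simp) (by simp; field_simp; ring)]
  · intro h
    refine ⟨_, h, plane_ext ?_ ?_⟩
    · simp; field_simp; ring
    · simp; field_simp; ring

lemma mem_image_flipX (S : Set Plane) (p : Plane) : p ∈ flipX '' S ↔ flipX p ∈ S :=
  ⟨by rintro ⟨x, hx, rfl⟩; rwa [flipX_flipX], fun h => ⟨_, h, flipX_flipX p⟩⟩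

lemma mem_image_flipY (S : Set Plane) (p : Plane) : p ∈ flipY '' S ↔ flipY p ∈ S :=
  ⟨by rintro ⟨x, hx, rfl⟩; rwa [flipY_flipY], fun h => ⟨_, h, flipY_flipY p⟩⟩

lemma tipMap_image_base (ha : a ∈ Ioo (0 : ℝ) 1) :
    tipMap a '' tri.base a = {p | a * p 0 + p 1 < 1 ∧ a < p 0 + a * p 1 ∧
      p 0 - a * p 1 < a ^ 3} := by
  have ha0 := ha.1
  ext p
  rw [mem_image_tipMap ha0]
  simp only [base, mem_ofPred_eq, Matrix.cons_val_zero, Matrix.cons_val_one]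
  have e1 : a * ((1 - p 1) / a) + (1 - p 0 / a) < 1 ↔ a < p 0 + a * p 1 := by
    rw [← mul_lt_mul_iff_right₀ ha0]
    field_simp
    constructor <;> intro h <;> linarith
  have e2 : a < (1 - p 1) / a + a * (1 - p 0 / a) ↔ a * p 0 + p 1 < 1 := by
    rw [← mul_lt_mul_iff_right₀ ha0]
    field_simp
    constructor <;> intro h <;> nlinarith
  have e3 : a * ((1 - p 1) / a) - (1 - p 0 / a) < a ^ 2 ↔ p 0 - a * p 1 < a ^ 3 := by
    rw [← mul_lt_mul_iff_right₀ ha0]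
    field_simp
    constructor <;> intro h <;> nlinarith
  rw [e1, e2, e3]
  tauto

lemma sideMap_image_base (ha : a ∈ Ioo (0 : ℝ) 1) :
    sideMap a '' dart.base a = {p | a * p 0 + |p 1 - halfHeight a| < 1 - halfHeight a ∧
      a * halfHeight a < p 0 - a + a * |p 1 - halfHeight a|} := by
  have h0 := halfHeight_pos ha
  have e : 2 * halfHeight a = 1 - a ^ 2 := by unfold halfHeight; ring
  ext p
  rw [mem_image_sideMap ha]
  simp only [base, mem_ofPred_eq, Matrix.cons_val_zero, Matrix.cons_val_one]
  have e0 : |p 1 / halfHeight a - 1| = |p 1 - halfHeight a| / halfHeight a := by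
    rw [← abs_of_pos h0, ← abs_div, abs_of_pos h0, sub_div, div_self h0.ne']
  rw [e0]
  refine and_congr ?_ ?_
  · rw [← mul_lt_mul_iff_right₀ h0, mul_one]
    have : halfHeight a * (a * ((p 0 - a) / halfHeight a) + |p 1 - halfHeight a| / halfHeight a)
      = a * (p 0 - a) + |p 1 - halfHeight a| := by field_simp
    rw [this]
    constructor <;> intro h <;> nlinarith
  · rw [← mul_lt_mul_iff_right₀ h0]
    have : halfHeight a * ((p 0 - a) / halfHeight a + a * (|p 1 - halfHeight a| / halfHeight a))
      = p 0 - a + a * |p 1 - halfHeight a| := by field_simp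
    rw [this, mul_comm a (halfHeight a)]

/-- The inscribed rhombus spans its shape, so what is left falls apart along an axis of the rhombus:
by the sign of `p 0` in the root, of `p 1` in the dart, and of `p 0 - a` in the triangle. In the
triangle the lower left edge of the rhombus lies on the side `p 0 + a * p 1 = a`, so nothing remains
there. -/
lemma base_diff_inscribed (ha : a ∈ Ioo (0 : ℝ) 1) (t : Shape) :
    t.base a \ t.inscribed a =
      t.nextMap a false '' (t.next false).base a ∪ t.nextMap a true '' (t.next true).base a := by
  have hh := halfHeight_pos ha
  have e : 2 * halfHeight a = 1 - a ^ 2 := by unfold halfHeight; ring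
  have ha' := ha
  obtain ⟨ha0, ha1⟩ := ha'
  ext p
  cases t <;> simp only [next, nextMap, Set.mem_sdiff, mem_union, image_id]
  · rw [mem_image_flipX, mem_inscribed_root]
    simp only [base, mem_ofPred_eq, flipX_zero, flipX_one, not_le]
    have key : ∀ x : ℝ, a * x + |p 1| < 1 → a < x + a * |p 1| → 0 ≤ x := by
      intro x h1 h2
      have : 0 ≤ (1 - a ^ 2) * x := by nlinarith
      exact nonneg_of_mul_nonneg_right this (by linarith)
    constructor
    · rintro ⟨h1, h2⟩
      rcases abs_cases (p 0) with ⟨e, h⟩ | ⟨e, h⟩ <;> rw [e] at h1 h2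
      · exact Or.inl ⟨h1, h2⟩
      · exact Or.inr ⟨h1, h2⟩
    · rintro (⟨h1, h2⟩ | ⟨h1, h2⟩)
      · rw [abs_of_nonneg (key _ h1 h2)]; exact ⟨h1, h2⟩
      · rw [← abs_neg, abs_of_nonneg (key _ h1 h2)]; exact ⟨h1, h2⟩
  · rw [mem_image_flipY, mem_inscribed_dart ha0]
    simp only [base, mem_ofPred_eq, flipY_zero, flipY_one, not_le]
    have key : ∀ y : ℝ, a < p 0 + a * y → a * p 0 - y < a ^ 2 → 0 ≤ y := by
      intro y h1 h2
      have : 0 ≤ (1 + a ^ 2) * y := by nlinarith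
      exact nonneg_of_mul_nonneg_right this (by positivity)
    have key2 : ∀ y : ℝ, a * p 0 + y < 1 → a * p 0 - y < a ^ 2 →
        halfHeight a < |a * p 0 - (a ^ 2 + 1) / 2| + y := by
      intro y h1 h2
      have := neg_le_abs (a * p 0 - (a ^ 2 + 1) / 2)
      linarith
    constructor
    · rintro ⟨⟨h1, h2⟩, h3⟩
      have h4 : a * p 0 - |p 1| < a ^ 2 := by
        rcases abs_cases (a * p 0 - (a ^ 2 + 1) / 2) with ⟨e, h⟩ | ⟨e, h⟩ <;> rw [e] at h3 <;>
          linarith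
      rcases abs_cases (p 1) with ⟨e, h⟩ | ⟨e, h⟩ <;> rw [e] at h1 h2 h4
      · exact Or.inl ⟨h1, h2, h4⟩
      · exact Or.inr ⟨h1, h2, h4⟩
    · rintro (⟨h1, h2, h3⟩ | ⟨h1, h2, h3⟩)
      · rw [abs_of_nonneg (key _ h2 h3)]; exact ⟨⟨h1, h2⟩, key2 _ h1 h3⟩
      · rw [← abs_neg (p 1), abs_of_nonneg (key _ h2 h3)]; exact ⟨⟨h1, h2⟩, key2 _ h1 h3⟩
  · rw [tipMap_image_base ha, sideMap_image_base ha, mem_inscribed_tri]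
    simp only [base, mem_ofPred_eq, not_le]
    constructor
    · rintro ⟨⟨h1, h2, h3⟩, h4⟩
      rcases abs_cases (p 0 - a) with ⟨e0, h⟩ | ⟨e0, h⟩ <;> rw [e0] at h4
      · refine Or.inr ⟨?_, by linarith⟩
        rcases abs_cases (p 1 - halfHeight a) with ⟨e1, h'⟩ | ⟨e1, h'⟩ <;> rw [e1] <;> linarith
      · refine Or.inl ⟨h1, h2, ?_⟩
        rcases abs_cases (p 1 - halfHeight a) with ⟨e1, h'⟩ | ⟨e1, h'⟩ <;> rw [e1] at h4 <;>
          nlinarith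
    · have q1 := le_abs_self (p 1 - halfHeight a)
      have q2 := neg_le_abs (p 1 - halfHeight a)
      have q3 := le_abs_self (p 0 - a)
      have q4 := neg_le_abs (p 0 - a)
      rintro (⟨h1, h2, h3⟩ | ⟨h1, h2⟩)
      · refine ⟨⟨h1, h2, ?_⟩, ?_⟩
        · have h5 : halfHeight a < p 1 := by
            have : a * halfHeight a < a * p 1 := by nlinarith
            exact lt_of_mul_lt_mul_left this ha0.le
          have h6 : p 0 < a := by
            have : (1 + a ^ 2) * p 0 < (1 + a ^ 2) * a := by nlinarith
            exact lt_of_mul_lt_mul_left this (by positivity)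
          nlinarith
        · nlinarith [mul_le_mul_of_nonneg_left q1 ha0.le]
      · have h3 : 0 ≤ p 0 - a := by
          have : 0 ≤ (1 - a ^ 2) * (p 0 - a) := by nlinarith
          exact nonneg_of_mul_nonneg_right this (by linarith)
        rw [abs_of_nonneg h3]
        have h6 : |p 1 - halfHeight a| < halfHeight a := by nlinarith
        refine ⟨⟨by linarith, ?_, by linarith⟩, h2⟩
        have : 0 < p 1 := by linarith
        nlinarith [mul_pos ha0 this]

lemma disjoint_children (ha : a ∈ Ioo (0 : ℝ) 1) (t : Shape) :
    Disjoint (t.nextMap a false '' (t.next false).base a)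
      (t.nextMap a true '' (t.next true).base a) := by
  have hh := halfHeight_pos ha
  have e : 2 * halfHeight a = 1 - a ^ 2 := by unfold halfHeight; ring
  have hd := fun x => dart_bounds ha (p := x)
  have ht := fun x => tri_bounds ha (p := x)
  have ha' := ha
  obtain ⟨ha0, ha1⟩ := ha'
  rw [Set.disjoint_left]
  intro p
  cases t <;> simp only [next, nextMap, image_id]
  · intro h1 h2
    rw [mem_image_flipX] at h2
    have k1 := (hd _ (base_subset_region _ h1)).1
    have k2 := (hd _ (base_subset_region _ h2)).1
    have : p 0 = 0 := le_antisymm (by simpa using k2) k1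
    obtain ⟨l1, l2⟩ := h1
    rw [this] at l1 l2
    nlinarith
  · intro h1 h2
    rw [mem_image_flipY] at h2
    have k1 := (ht _ (base_subset_region _ h1)).2.1
    have k2 := (ht _ (base_subset_region _ h2)).2.1
    have : p 1 = 0 := le_antisymm (by simpa using k2) k1
    obtain ⟨l1, l2, l3⟩ := h1
    rw [this] at l1 l2 l3
    nlinarith
  · rw [tipMap_image_base ha, sideMap_image_base ha]
    rintro ⟨h1, h2, h3⟩ ⟨h4, h5⟩
    have q1 := le_abs_self (p 1 - halfHeight a)
    have h5 : p 0 < a := by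
      have : (1 + a ^ 2) * p 0 < (1 + a ^ 2) * a := by nlinarith
      exact lt_of_mul_lt_mul_left this (by positivity)
    have h6 : 0 ≤ (1 - a ^ 2) * (p 0 - a) := by nlinarith
    have := nonneg_of_mul_nonneg_right h6 (by linarith)
    linarith

end Shape

namespace Shape

variable {a : ℝ}

/-! ### Edges under splitting -/

/-- Orientations alternate, so an old edge keeps its orientation while the orientation to be placed
next changes: "same" for the parent becomes "opposite" for the child. The next lemma is the reverse
exchange, and the third covers the new edges contributed by the inscribed rhombus. -/
lemma oppEdges_of_sameEdges (ha : a ∈ Ioo (0 : ℝ) 1) (t : Shape) (b : Bool) {x : Plane}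
    (hx : x ∈ (t.next b).region a) (h : t.nextMap a b x ∈ t.sameEdges a) :
    x ∈ (t.next b).oppEdges a := by
  have hh := halfHeight_pos ha
  have e : 2 * halfHeight a = 1 - a ^ 2 := by unfold halfHeight; ring
  have hd := fun h => dart_bounds ha (p := x) h
  have ht := fun h => tri_bounds ha (p := x) h
  obtain ⟨ha0, ha1⟩ := ha
  cases t <;> cases b <;> simp only [next, nextMap, id] at *
  · exact h.elim
  · exact h.elim
  · have := h.2
    rw [abs_of_nonneg (ht hx).2.1] at this
    exact ⟨hx, Or.inl this⟩
  · have := h.2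
    rw [flipY_one, abs_neg, abs_of_nonneg (ht hx).2.1] at this
    exact ⟨hx, Or.inl this⟩
  · refine ⟨hx, Or.inl ?_⟩
    have := h.2
    simp only [tipMap_zero, tipMap_one] at this
    refine mul_left_cancel₀ ha0.ne' ?_
    linear_combination -this
  · refine ⟨hx, ?_⟩
    have := h.2
    simp only [sideMap_zero, sideMap_one] at this
    obtain ⟨h1, h2⟩ := hd hx
    have l2 := neg_le_abs (x 1)
    -- The sub-dart meets this side of the triangle only at the right angle `(a, 0)`, the image of
    -- `(0, -1)`; the estimates force the equation of the opposite edges there.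
    have l3 : 0 ≤ halfHeight a * (a * (|x 1| + x 1)) := by
      have : 0 ≤ |x 1| + x 1 := by linarith
      positivity
    have l4 : 0 ≤ a * (1 - |x 1|) := mul_nonneg ha0.le (by linarith)
    have l5 : halfHeight a * (x 0 + a * |x 1| - a) ≤ 0 := by nlinarith [mul_nonneg hh.le h1]
    have l6 : x 0 + a * |x 1| - a ≤ 0 := by
      by_contra! hc
      exact absurd l5 (not_le.2 (mul_pos hh hc))
    exact le_antisymm (by linarith) hx.2

lemma sameEdges_of_oppEdges (ha : a ∈ Ioo (0 : ℝ) 1) (t : Shape) (b : Bool) {x : Plane}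
    (hx : x ∈ (t.next b).region a) (h : t.nextMap a b x ∈ t.oppEdges a) :
    x ∈ (t.next b).sameEdges a := by
  have hh := halfHeight_pos ha
  have e : 2 * halfHeight a = 1 - a ^ 2 := by unfold halfHeight; ring
  have hd := fun h => dart_bounds ha (p := x) h
  have ht := fun h => tri_bounds ha (p := x) h
  obtain ⟨ha0, ha1⟩ := ha
  cases t <;> cases b <;> simp only [next, nextMap, id] at *
  · refine ⟨hx, ?_⟩
    have : a * |x 0| + |x 1| = 1 := h
    rwa [abs_of_nonneg (hd hx).1] at this
  · refine ⟨hx, ?_⟩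
    have : a * |-x 0| + |x 1| = 1 := h
    rwa [abs_neg, abs_of_nonneg (hd hx).1] at this
  · have := h.2
    rw [abs_of_nonneg (ht hx).2.1] at this
    exact ⟨hx, this⟩
  · have := h.2
    rw [flipY_one, abs_neg, abs_of_nonneg (ht hx).2.1] at this
    exact ⟨hx, this⟩
  · refine ⟨hx, ?_⟩
    obtain ⟨-, h | h⟩ := h <;> simp only [tipMap_zero, tipMap_one] at h
    · refine mul_left_cancel₀ ha0.ne' ?_
      linarith
    -- The tip triangle does not reach this edge, so the hypotheses are contradictory.
    · obtain ⟨h1, h2, h3⟩ := ht hx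
      obtain ⟨k1, k2, k3⟩ := hx
      nlinarith
  · refine ⟨hx, ?_⟩
    obtain ⟨-, h | h⟩ := h <;> simp only [sideMap_zero, sideMap_one] at h
    · refine le_antisymm hx.1 ?_
      have l1 := le_abs_self (x 1)
      have : halfHeight a * (a * x 0 + x 1) = halfHeight a * 1 := by linarith
      have := mul_left_cancel₀ hh.ne' this
      linarith
    · refine le_antisymm hx.1 ?_
      have l1 := neg_le_abs (x 1)
      have : halfHeight a * (a * x 0 - x 1) = halfHeight a * 1 := by linarith
      have := mul_left_cancel₀ hh.ne' this
      linarith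

lemma oppEdges_of_inscribed (ha : a ∈ Ioo (0 : ℝ) 1) (t : Shape) (b : Bool) {x : Plane}
    (hx : x ∈ (t.next b).region a) (h : t.nextMap a b x ∈ t.inscribed a) :
    x ∈ (t.next b).oppEdges a := by
  have hh := halfHeight_pos ha
  have e : 2 * halfHeight a = 1 - a ^ 2 := by unfold halfHeight; ring
  have hd := fun h => dart_bounds ha (p := x) h
  have ht := fun h => tri_bounds ha (p := x) h
  obtain ⟨ha0, ha1⟩ := ha
  cases t <;> cases b <;> simp only [next, nextMap, id] at *
  · rw [mem_inscribed_root] at h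
    rw [abs_of_nonneg (hd hx).1] at h
    exact ⟨hx, le_antisymm h hx.2⟩
  · rw [mem_inscribed_root, flipX_zero, flipX_one, abs_neg] at h
    rw [abs_of_nonneg (hd hx).1] at h
    exact ⟨hx, le_antisymm h hx.2⟩
  · rw [mem_inscribed_dart ha0, abs_of_nonneg (ht hx).2.1] at h
    have := neg_le_abs (a * x 0 - (a ^ 2 + 1) / 2)
    exact ⟨hx, Or.inr (le_antisymm hx.2.2 (by linarith))⟩
  · rw [mem_inscribed_dart ha0, flipY_zero, flipY_one, abs_neg, abs_of_nonneg (ht hx).2.1] at h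
    have := neg_le_abs (a * x 0 - (a ^ 2 + 1) / 2)
    exact ⟨hx, Or.inr (le_antisymm hx.2.2 (by linarith))⟩
  · rw [mem_inscribed_tri] at h
    simp only [tipMap_zero, tipMap_one] at h
    have l1 := neg_le_abs (a * (1 - x 1) - a)
    have l2 := mul_le_mul_of_nonneg_left (le_abs_self (1 - a * x 0 - halfHeight a)) ha0.le
    refine ⟨hx, Or.inr (le_antisymm hx.2.2 ?_)⟩
    refine le_of_mul_le_mul_left ?_ ha0
    nlinarith
  · rw [mem_inscribed_tri] at h
    simp only [sideMap_zero, sideMap_one, add_sub_cancel_left, abs_mul, abs_of_pos hh,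
      abs_of_nonneg (hd hx).1] at h
    refine ⟨hx, le_antisymm ?_ hx.2⟩
    refine le_of_mul_le_mul_left ?_ hh
    linarith

/-- Together with `nextMap_sameEdges` this traces every boundary edge of a region back to the
rhombus that produced it. -/
lemma nextMap_oppEdges (ha : a ∈ Ioo (0 : ℝ) 1) (t : Shape) (b : Bool) {x : Plane}
    (hx : x ∈ (t.next b).oppEdges a) :
    t.nextMap a b x ∈ t.sameEdges a ∨ t.nextMap a b x ∈ frontier (t.inscribed a) := by
  have hh := halfHeight_pos ha
  have e : 2 * halfHeight a = 1 - a ^ 2 := by unfold halfHeight; ring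
  have hd := fun h => dart_bounds ha (p := x) h
  have ht := fun h => tri_bounds ha (p := x) h
  have hm := fun h => nextMap_mem_region ha t b (x := x) h
  have ha' := ha
  obtain ⟨ha0, ha1⟩ := ha'
  cases t <;> cases b <;> simp only [next, nextMap, id] at *
  · right
    rw [mem_frontier_inscribed_root ha, abs_of_nonneg (hd hx.1).1]
    exact hx.2
  · right
    rw [mem_frontier_inscribed_root ha, flipX_zero, abs_neg, abs_of_nonneg (hd hx.1).1]
    exact hx.2
  · obtain ⟨h1, h | h⟩ := hx
    · left
      refine ⟨hm h1, ?_⟩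
      rwa [abs_of_nonneg (ht h1).2.1]
    · right
      rw [mem_frontier_inscribed_dart ha, abs_of_nonneg (ht h1).2.1, abs_of_nonpos]
      · linarith
      · linarith [h1.1]
  · obtain ⟨h1, h | h⟩ := hx
    · left
      refine ⟨hm h1, ?_⟩
      rwa [flipY_one, abs_neg, abs_of_nonneg (ht h1).2.1]
    · right
      rw [mem_frontier_inscribed_dart ha, flipY_one, flipY_zero, abs_neg,
        abs_of_nonneg (ht h1).2.1, abs_of_nonpos]
      · linarith
      · linarith [h1.1]
  · obtain ⟨h1, h | h⟩ := hx
    · left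
      refine ⟨hm h1, ?_⟩
      simp only [tipMap_zero, tipMap_one]
      linear_combination (-a) * h
    · right
      rw [mem_frontier_inscribed_tri ha]
      simp only [tipMap_zero, tipMap_one]
      have k1 := h1.1
      rw [abs_of_nonpos, abs_of_nonneg]
      · linear_combination (-a) * h - a * e
      · linarith
      · linarith [mul_nonneg ha0.le (ht h1).2.1]
  · right
    rw [mem_frontier_inscribed_tri ha]
    simp only [sideMap_zero, sideMap_one, add_sub_cancel_left, abs_mul, abs_of_pos hh,
      abs_of_nonneg (hd hx.1).1]
    rw [show halfHeight a * x 0 + a * (halfHeight a * |x 1|) = halfHeight a * (x 0 + a * |x 1|) by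
      ring, hx.2, mul_comm]

lemma nextMap_sameEdges (ha : a ∈ Ioo (0 : ℝ) 1) (t : Shape) (b : Bool) {x : Plane}
    (hx : x ∈ (t.next b).sameEdges a) : t.nextMap a b x ∈ t.oppEdges a := by
  have hh := halfHeight_pos ha
  have e : 2 * halfHeight a = 1 - a ^ 2 := by unfold halfHeight; ring
  have hd := fun h => dart_bounds ha (p := x) h
  have ht := fun h => tri_bounds ha (p := x) h
  have hm := fun h => nextMap_mem_region ha t b (x := x) h
  obtain ⟨ha0, ha1⟩ := ha
  cases t <;> cases b <;> simp only [next, nextMap, id] at *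
  · change a * |x 0| + |x 1| = 1
    rw [abs_of_nonneg (hd hx.1).1]; exact hx.2
  · change a * |-x 0| + |x 1| = 1
    rw [abs_neg, abs_of_nonneg (hd hx.1).1]; exact hx.2
  · refine ⟨hm hx.1, ?_⟩
    rw [abs_of_nonneg (ht hx.1).2.1]; exact hx.2
  · refine ⟨hm hx.1, ?_⟩
    rw [flipY_zero, flipY_one, abs_neg, abs_of_nonneg (ht hx.1).2.1]; exact hx.2
  · refine ⟨hm hx.1, Or.inl ?_⟩
    simp only [tipMap_zero, tipMap_one]
    nlinarith [hx.2]
  · refine ⟨hm hx.1, ?_⟩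
    have h2 := hx.2
    simp only [sideMap_zero, sideMap_one]
    rcases abs_cases (x 1) with ⟨e', h⟩ | ⟨e', h⟩ <;> rw [e'] at h2
    · left; linear_combination halfHeight a * h2 + e
    · right; linear_combination halfHeight a * h2

/-! ### Corners -/

/-- The points where the inscribed rhombus of a shape meets its opposite edges. -/
def corners (a : ℝ) : Shape → Set Plane
  | root => {!₂[0, 1], !₂[0, -1]}
  | dart => {!₂[a, 0]}
  | tri => {!₂[a, 1 - a ^ 2], !₂[a, 0]}

lemma mid_mem_frontier (ha : a ∈ Ioo (0 : ℝ) 1) (t : Shape) :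
    t.mid a ∈ frontier (t.inscribed a) := by
  have hh := halfHeight_pos ha
  have e : 2 * halfHeight a = 1 - a ^ 2 := by unfold halfHeight; ring
  cases t
  · rw [mem_frontier_inscribed_root ha]
    simp [mid]
  · rw [mem_frontier_inscribed_dart ha, abs_of_nonpos]
    · simp [mid]; linarith
    · simp [mid]; linarith
  · rw [mem_frontier_inscribed_tri ha]
    simp only [mid, Matrix.cons_val_zero, Matrix.cons_val_one]
    rw [show 1 - a ^ 2 - halfHeight a = halfHeight a by linarith]
    simp [abs_of_pos hh]

lemma mid_mem_oppEdges (ha : a ∈ Ioo (0 : ℝ) 1) (t : Shape) : t.mid a ∈ t.oppEdges a := by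
  have hm := inscribed_subset ha t ((isClosed_rhombus _ _ _ _).frontier_subset
    (mid_mem_frontier ha t))
  cases t
  · simp [mid, oppEdges]
  · exact ⟨hm, by simp [mid]⟩
  · refine ⟨hm, Or.inl ?_⟩
    simp [mid]
    ring

/-- Edges of opposite orientations have slopes `±a` and `±1 / a`, so the rhombus touches opposite
edges only at vertices, whereas it may share a segment with an edge of its own orientation. -/
lemma inscribed_inter_oppEdges (ha : a ∈ Ioo (0 : ℝ) 1) (t : Shape) :
    t.inscribed a ∩ t.oppEdges a ⊆ t.corners a := by
  have hh := halfHeight_pos ha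
  have e : 2 * halfHeight a = 1 - a ^ 2 := by unfold halfHeight; ring
  have ha' := ha
  obtain ⟨ha0, ha1⟩ := ha'
  rintro p ⟨h1, h2⟩
  cases t
  · rw [mem_inscribed_root] at h1
    have h2 : a * |p 0| + |p 1| = 1 := h2
    have h3 := abs_nonneg (p 0)
    have h4 : (1 - a ^ 2) * |p 0| ≤ (1 - a ^ 2) * 0 := by nlinarith
    have h5 : |p 0| = 0 := le_antisymm (le_of_mul_le_mul_left h4 (by linarith)) h3
    rw [h5, mul_zero, zero_add] at h2
    have h6 := abs_eq_zero.1 h5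
    rcases (abs_eq zero_le_one).1 h2 with h | h
    · left; exact plane_ext (by simpa using h6) (by simpa using h)
    · right; exact plane_ext (by simpa using h6) (by simpa using h)
  · rw [mem_inscribed_dart ha0] at h1
    obtain ⟨-, h2⟩ := h2
    have h3 := neg_le_abs (a * p 0 - (a ^ 2 + 1) / 2)
    have h4 : (1 + a ^ 2) * |p 1| ≤ (1 + a ^ 2) * 0 := by nlinarith
    have h5 : |p 1| = 0 := le_antisymm (le_of_mul_le_mul_left h4 (by positivity)) (abs_nonneg _)
    rw [h5, mul_zero, add_zero] at h2
    exact plane_ext (by simpa using h2) (by simpa using h5)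
  · rw [mem_inscribed_tri] at h1
    obtain ⟨-, h2 | h2⟩ := h2
    · left
      have h3 := mul_le_mul_of_nonneg_left (le_abs_self (p 1 - halfHeight a)) ha0.le
      have h5 : p 0 = a := by
        have l1 := le_abs_self (p 0 - a)
        have l2 : a * (p 1 - halfHeight a) = a * halfHeight a - a ^ 2 * (p 0 - a) := by
          linear_combination a * h2 - a * e
        have l3 : (1 - a ^ 2) * |p 0 - a| ≤ (1 - a ^ 2) * 0 := by
          nlinarith [mul_le_mul_of_nonneg_left l1 (sq_nonneg a)]
        have l4 := le_of_mul_le_mul_left l3 (by linarith)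
        linarith [abs_eq_zero.1 (le_antisymm l4 (abs_nonneg _))]
      refine plane_ext (by simpa using h5) ?_
      change p 1 = 1 - a ^ 2
      rw [h5] at h2; linarith
    · right
      have h3 := mul_le_mul_of_nonneg_left (neg_le_abs (p 1 - halfHeight a)) ha0.le
      have h5 : p 0 = a := by
        have l1 := neg_le_abs (p 0 - a)
        have l1 := le_abs_self (p 0 - a)
        have l2 : a * -(p 1 - halfHeight a) = a * halfHeight a - a ^ 2 * (p 0 - a) := by
          linear_combination a * h2
        have l3 : (1 - a ^ 2) * |p 0 - a| ≤ (1 - a ^ 2) * 0 := by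
          nlinarith [mul_le_mul_of_nonneg_left l1 (sq_nonneg a)]
        have l4 := le_of_mul_le_mul_left l3 (by linarith)
        linarith [abs_eq_zero.1 (le_antisymm l4 (abs_nonneg _))]
      refine plane_ext (by simpa using h5) ?_
      change p 1 = 0
      rw [h5] at h2; linarith

/-- The two subregions meet only in corners; for the bounded shapes only in the middle point. -/
lemma eq_corner_of_nextMap_eq (ha : a ∈ Ioo (0 : ℝ) 1) (t : Shape) {x y : Plane}
    (hx : x ∈ (t.next false).region a) (hy : y ∈ (t.next true).region a)
    (h : t.nextMap a false x = t.nextMap a true y) :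
    t.nextMap a false x = t.mid a ∨ (t = root ∧ x = !₂[0, -1]) := by
  have hh := halfHeight_pos ha
  have e : 2 * halfHeight a = 1 - a ^ 2 := by unfold halfHeight; ring
  have hd := fun z h => dart_bounds ha (p := z) h
  have ht := fun z h => tri_bounds ha (p := z) h
  have ha' := ha
  obtain ⟨ha0, ha1⟩ := ha'
  cases t <;> simp only [next, nextMap, id] at *
  · have h0 : x 0 = -y 0 := by rw [h]; rfl
    have h1 : x 0 = 0 := by linarith [(hd x hx).1, (hd y hy).1]
    have h2 : |x 1| = 1 := by
      refine le_antisymm (hd x hx).2 ?_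
      have := hx.2
      rw [h1, zero_add] at this
      exact le_of_mul_le_mul_left (by simpa using this) ha0
    rcases (abs_eq zero_le_one).1 h2 with h | h
    · left; exact plane_ext (by simpa [mid] using h1) (by simpa [mid] using h)
    · right; exact ⟨trivial, plane_ext (by simpa using h1) (by simpa using h)⟩
  · left
    have h0 : x 1 = -y 1 := by rw [h]; rfl
    have h1 : x 1 = 0 := by linarith [(ht x hx).2.1, (ht y hy).2.1]
    obtain ⟨k1, k2, k3⟩ := hx
    rw [h1] at k1 k2 k3
    refine plane_ext ?_ (by simpa [mid] using h1)
    change x 0 = a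
    refine le_antisymm ?_ (by linarith)
    refine le_of_mul_le_mul_left (a := a) ?_ ha0
    linarith
  · left
    have h0 : a * (1 - x 1) = a + halfHeight a * y 0 := congrArg (fun p : Plane => p 0) h
    have h1 := mul_nonneg hh.le (hd y hy).1
    have h2 := mul_nonneg ha0.le (ht x hx).2.1
    have h3 : x 1 = 0 := by
      have : a * x 1 = 0 := by linarith
      exact (mul_eq_zero.1 this).resolve_left ha0.ne'
    obtain ⟨k1, k2, k3⟩ := hx
    rw [h3] at k1 k2 k3
    have h4 : x 0 = a := by
      refine le_antisymm ?_ (by linarith)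
      refine le_of_mul_le_mul_left (a := a) ?_ ha0
      linarith
    refine plane_ext ?_ ?_
    · simp [mid, h3]
    · simp [mid, h4]; ring

end Shape

lemma connectedComponentIn_eq_left {X : Type*} [TopologicalSpace X] {A u v : Set X} {x : X}
    (hA : A = u ∪ v) (hu : IsOpen u) (hv : IsOpen v) (huv : Disjoint u v) (hc : IsPreconnected u)
    (hx : x ∈ u) : connectedComponentIn A x = u := by
  have hxA : x ∈ A := hA ▸ Or.inl hx
  refine Subset.antisymm ?_ (hc.subset_connectedComponentIn hx (hA ▸ subset_union_left))
  exact isPreconnected_connectedComponentIn.subset_left_of_subset_union hu hv huv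
    (hA ▸ connectedComponentIn_subset A x) ⟨x, mem_connectedComponentIn hxA, hx⟩

namespace Shape

variable {a : ℝ}

/-- The standard triangle lies in the standard dart, which lies in the root, where both coordinates
are at most `1 / a` in absolute value. -/
lemma dist_le_of_mem_region (ha : a ∈ Ioo (0 : ℝ) 1) (t : Shape) {x y : Plane}
    (hx : x ∈ t.region a) (hy : y ∈ t.region a) : dist x y ≤ 4 / a := by
  have hroot : ∀ x ∈ root.region a, |x 0| ≤ 1 / a ∧ |x 1| ≤ 1 / a := fun x hx => by
    have hx : a * |x 0| + |x 1| ≤ 1 := hx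
    have h0 := abs_nonneg (x 0)
    have h1 := abs_nonneg (x 1)
    constructor <;> rw [le_div_iff₀ ha.1] <;> nlinarith [ha.1, ha.2]
  have hd : ∀ x ∈ root.region a, ∀ y ∈ root.region a, dist x y ≤ 4 / a :=
    fun x hx y hy => (dist_le_of_abs
      ((abs_sub _ _).trans (add_le_add (hroot x hx).1 (hroot y hy).1))
      ((abs_sub _ _).trans (add_le_add (hroot x hx).2 (hroot y hy).2))).trans_eq (by ring)
  have hdart : dart.region a ⊆ root.region a := fun x hx => nextMap_mem_region ha root false hx
  have htri : tri.region a ⊆ dart.region a := fun x hx => nextMap_mem_region ha dart false hx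
  cases t
  · exact hd x hx y hy
  · exact hd x (hdart hx) y (hdart hy)
  · exact hd x (hdart (htri hx)) y (hdart (htri hy))

/-! ### Iterated subregions -/

/-- The shape of the subregion with address `w` of a shape. -/
def shapeAt : Shape → List Bool → Shape
  | t, [] => t
  | t, b :: w => shapeAt (t.next b) w

/-- The position of the subregion with address `w` of a shape. -/
def mapAt (a : ℝ) : Shape → List Bool → Plane → Plane
  | _, [] => id
  | t, b :: w => t.nextMap a b ∘ mapAt a (t.next b) w

/-- The rhombus placed into the subregion with address `w` of a shape. -/
def rhombusAt (a : ℝ) (t : Shape) (w : List Bool) : Set Plane :=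
  t.mapAt a w '' (t.shapeAt w).inscribed a

/-- Addresses are read from the outermost split inwards. Self-similarity peels off the first letter,
while the construction appends a last one; this lemma and the next give the second view. -/
lemma shapeAt_concat (t : Shape) (w : List Bool) (b : Bool) :
    t.shapeAt (w ++ [b]) = (t.shapeAt w).next b := by
  induction w generalizing t with
  | nil => rfl
  | cons c w ih => exact ih _

lemma mapAt_concat (t : Shape) (w : List Bool) (b : Bool) :
    t.mapAt a (w ++ [b]) = t.mapAt a w ∘ (t.shapeAt w).nextMap a b := by
  induction w generalizing t with
  | nil => rfl
  | cons c w ih => exact congrArg _ (ih _)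

lemma mapAt_mem_region (ha : a ∈ Ioo (0 : ℝ) 1) (t : Shape) (w : List Bool) {x : Plane}
    (hx : x ∈ (t.shapeAt w).region a) : t.mapAt a w x ∈ t.region a := by
  induction w generalizing t with
  | nil => exact hx
  | cons b w ih => exact nextMap_mem_region ha t b (ih _ hx)

/-- A number bounding the shrinking of the regions per iteration. -/
def rate (a : ℝ) : ℝ := √(max a (halfHeight a))

lemma rate_pos (ha : a ∈ Ioo (0 : ℝ) 1) : 0 < rate a := Real.sqrt_pos.2 (lt_max_of_lt_left ha.1)

lemma rate_lt_one (ha : a ∈ Ioo (0 : ℝ) 1) : rate a < 1 := by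
  rw [rate, Real.sqrt_lt' one_pos]
  refine max_lt (by linarith [ha.2]) ?_
  unfold halfHeight
  nlinarith [ha.1]

lemma rate_sq (ha : a ∈ Ioo (0 : ℝ) 1) : rate a * rate a = max a (halfHeight a) :=
  Real.mul_self_sqrt (le_max_of_le_left ha.1.le)

/-- Weights of the shapes making the ratios of the maps to subregions comparable. -/
def weight (a : ℝ) : Shape → ℝ
  | root => rate a * rate a
  | dart => rate a
  | tri => 1

lemma weight_le_one (ha : a ∈ Ioo (0 : ℝ) 1) (t : Shape) : t.weight a ≤ 1 := by
  have h0 := rate_pos ha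
  have h1 := rate_lt_one ha
  cases t
  · exact (mul_lt_one_of_nonneg_of_lt_one_left h0.le h1 h1.le).le
  · exact h1.le
  · exact le_rfl

/-- The steps from root to dart and from dart to triangle are isometric, so single steps need not
contract. A dart step followed by a triangle step does, and the weights spread that contraction
evenly over both. -/
lemma exists_isSim_nextMap_le (ha : a ∈ Ioo (0 : ℝ) 1) (t : Shape) (b : Bool) :
    ∃ r σ, IsSim a r σ (t.nextMap a b) ∧ σ (t.next b).orient = t.orient.opp ∧
      r * t.weight a ≤ rate a * (t.next b).weight a := by
  have h0 := rate_pos ha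
  have h1 := rate_lt_one ha
  have h2 := rate_sq ha
  cases t <;> cases b
  · exact ⟨_, _, .id a, rfl, (one_mul _).le⟩
  · exact ⟨_, _, isSim_flipX a, rfl, (one_mul _).le⟩
  · exact ⟨_, _, .id a, rfl, by simp [weight, next]⟩
  · exact ⟨_, _, isSim_flipY a, rfl, by simp [weight, next]⟩
  · refine ⟨_, _, isSim_tipMap ha, rfl, ?_⟩
    simp only [weight, next, mul_one]
    have := le_max_left a (halfHeight a)
    nlinarith
  · refine ⟨_, _, isSim_sideMap ha, rfl, ?_⟩
    simp only [weight, next, mul_one, h2]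
    exact le_max_right _ _

lemma exists_isSim_mapAt (ha : a ∈ Ioo (0 : ℝ) 1) (t : Shape) (w : List Bool) :
    ∃ r σ, IsSim a r σ (t.mapAt a w) ∧
      σ (t.shapeAt w).orient = Orientation.opp^[w.length] t.orient ∧
      r * t.weight a ≤ rate a ^ w.length * (t.shapeAt w).weight a := by
  induction w generalizing t with
  | nil => exact ⟨1, id, .id a, rfl, by simp [shapeAt]⟩
  | cons b w ih =>
    obtain ⟨r, σ, h, hσ, hr⟩ := exists_isSim_nextMap_le ha t b
    obtain ⟨r', σ', h', hσ', hr'⟩ := ih (t.next b)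
    refine ⟨_, _, h.comp h', ?_, ?_⟩
    -- `σ` commutes with `Orientation.opp`, hence with its iterates, so the alternation inside the
    -- child is seen unchanged from the parent.
    · have key : ∀ n : ℕ, σ (Orientation.opp^[n] (t.next b).orient) =
          Orientation.opp^[n] (σ (t.next b).orient) := fun n => by
        induction n with
        | zero => rfl
        | succ n ih => rw [Function.iterate_succ_apply', Function.iterate_succ_apply', h.opp, ih]
      rw [Function.comp, shapeAt, hσ', key, hσ, List.length_cons, Function.iterate_succ_apply]
    · rw [shapeAt, List.length_cons, pow_succ]
      calc r * r' * t.weight a = r' * (r * t.weight a) := by ring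
        _ ≤ r' * (rate a * (t.next b).weight a) := mul_le_mul_of_nonneg_left hr h'.pos.le
        _ = rate a * (r' * (t.next b).weight a) := by ring
        _ ≤ rate a * (rate a ^ w.length * ((t.next b).shapeAt w).weight a) :=
          mul_le_mul_of_nonneg_left hr' (rate_pos ha).le
        _ = _ := by ring

lemma orientationAt_eq_iterate (n : ℕ) :
    orientationAt (n + 1) = Orientation.opp^[n] root.orient := by
  induction n with
  | zero => simp [orientationAt, orient]
  | succ n ih => rw [orientationAt_succ, ih, Function.iterate_succ_apply']

lemma exists_isSim_root (ha : a ∈ Ioo (0 : ℝ) 1) (w : List Bool) :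
    ∃ r σ, IsSim a r σ (root.mapAt a w) ∧
      σ (root.shapeAt w).orient = orientationAt (w.length + 1) ∧
      r ≤ rate a ^ w.length / rate a ^ 2 := by
  obtain ⟨r, σ, h, hσ, hr⟩ := exists_isSim_mapAt ha root w
  refine ⟨r, σ, h, by rw [hσ, orientationAt_eq_iterate], ?_⟩
  have h0 := rate_pos ha
  rw [le_div_iff₀ (by positivity), sq]
  exact hr.trans (mul_le_of_le_one_right (by positivity) (weight_le_one ha _))

/-! ### Identification of the construction with the addressed subregions. -/

lemma isLargestRhombus_closure_iff (ha : a ∈ Ioo (0 : ℝ) 1) (t : Shape) {r : ℝ}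
    {σ : Orientation → Orientation} {φ : Plane → Plane} (h : IsSim a r σ φ) (R : Set Plane) :
    IsLargestRhombus a (σ t.orient) (closure (φ '' t.base a)) R ↔ R = φ '' t.inscribed a := by
  rw [h.image_closure, closure_base ha]
  refine h.isLargestRhombus_image_iff (size_pos ha t) (inscribed_subset ha t) ?_ ?_ R
  · intro c s hs
    -- Maximality quantifies over all real sizes, so nonpositive `s` is disposed of first.
    rcases le_total s 0 with h0 | h0
    · exact h0.trans (size_pos ha t).le
    · exact (size_le_and_centre_eq ha t h0 hs).1
  · intro c hc
    exact (size_le_and_centre_eq ha t (size_pos ha t).le hc).2 rfl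

/-- The two pieces left over are disjoint, open and connected, so they are exactly the connected
components. -/
lemma component_iff (ha : a ∈ Ioo (0 : ℝ) 1) (t : Shape) {r : ℝ}
    {σ : Orientation → Orientation} {φ : Plane → Plane} (h : IsSim a r σ φ) (W : Set Plane) :
    (∃ x ∈ φ '' t.base a \ φ '' t.inscribed a,
      W = connectedComponentIn (φ '' t.base a \ φ '' t.inscribed a) x) ↔
    ∃ b, W = (φ ∘ t.nextMap a b) '' (t.next b).base a := by
  have hA : φ '' t.base a \ φ '' t.inscribed a =
      (φ ∘ t.nextMap a false) '' (t.next false).base a ∪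
      (φ ∘ t.nextMap a true) '' (t.next true).base a := by
    rw [← image_sdiff h.injective, base_diff_inscribed ha, image_union, image_comp, image_comp]
  have hdis : Disjoint ((φ ∘ t.nextMap a false) '' (t.next false).base a)
      ((φ ∘ t.nextMap a true) '' (t.next true).base a) := by
    rw [image_comp, image_comp, disjoint_image_iff h.injective]
    exact disjoint_children ha t
  have hsim : ∀ b, ∃ r σ, IsSim a r σ (φ ∘ t.nextMap a b) := fun b => by
    obtain ⟨r', σ', h', -⟩ := exists_isSim_nextMap_le ha t b
    exact ⟨_, _, h.comp h'⟩
  have hopen : ∀ b, IsOpen ((φ ∘ t.nextMap a b) '' (t.next b).base a) := fun b => by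
    obtain ⟨r', σ', h'⟩ := hsim b
    exact h'.isOpen_image (isOpen_base _)
  have hconn : ∀ b, IsPreconnected ((φ ∘ t.nextMap a b) '' (t.next b).base a) := fun b => by
    obtain ⟨r', σ', h'⟩ := hsim b
    exact (isPreconnected_base ha _).image _ h'.continuous.continuousOn
  have hcomp : ∀ b, ∀ x ∈ (φ ∘ t.nextMap a b) '' (t.next b).base a,
      connectedComponentIn (φ '' t.base a \ φ '' t.inscribed a) x =
        (φ ∘ t.nextMap a b) '' (t.next b).base a := by
    rintro (_ | _) x hx
    · exact connectedComponentIn_eq_left hA (hopen _) (hopen _) hdis (hconn _) hx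
    · exact connectedComponentIn_eq_left (hA.trans (union_comm _ _)) (hopen _) (hopen _) hdis.symm
        (hconn _) hx
  constructor
  · rintro ⟨x, hx, rfl⟩
    have hx' := hx
    rw [hA] at hx'
    rcases hx' with hx' | hx'
    · exact ⟨_, hcomp _ _ hx'⟩
    · exact ⟨_, hcomp _ _ hx'⟩
  · rintro ⟨b, rfl⟩
    obtain ⟨x, hx⟩ := (base_nonempty ha (t.next b)).image (φ ∘ t.nextMap a b)
    refine ⟨x, ?_, (hcomp b x hx).symm⟩
    rw [hA]
    cases b
    · exact Or.inl hx
    · exact Or.inr hx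

end Shape

open Shape

variable {a : ℝ}

lemma mem_emptyRegions_iff (ha : a ∈ Ioo (0 : ℝ) 1) (k : ℕ) (U : Set Plane) :
    U ∈ emptyRegions a k ↔
      ∃ w : List Bool, w.length = k ∧ U = root.mapAt a w '' (root.shapeAt w).base a := by
  induction k generalizing U with
  | zero =>
    simp only [emptyRegions, mem_singleton_iff, List.length_eq_zero_iff, exists_eq_left, mapAt,
      shapeAt, image_id, interior_initialRhombus ha.1]
  | succ k ih =>
    simp only [emptyRegions, mem_ofPred_eq]
    constructor
    · rintro ⟨V, hV, R, hR, x, hx, rfl⟩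
      obtain ⟨w, rfl, rfl⟩ := (ih V).1 hV
      obtain ⟨r, σ, h, hσ, -⟩ := exists_isSim_root ha w
      rw [← hσ, isLargestRhombus_closure_iff ha _ h] at hR
      subst hR
      obtain ⟨b, hb⟩ := (component_iff ha _ h _).1 ⟨x, hx, rfl⟩
      exact ⟨w ++ [b], by simp, by rw [hb, mapAt_concat, shapeAt_concat]⟩
    · rintro ⟨w, hw, rfl⟩
      obtain rfl | ⟨v, b, rfl⟩ := w.eq_nil_or_concat
      · simp at hw
      rw [List.concat_eq_append] at hw ⊢
      have hv : v.length = k := by simpa using hw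
      obtain ⟨r, σ, h, hσ, -⟩ := exists_isSim_root ha v
      obtain ⟨x, hx, hW⟩ := (component_iff ha _ h _).2 ⟨b, rfl⟩
      refine ⟨_, (ih _).2 ⟨v, hv, rfl⟩, rhombusAt a root v, ?_, x, hx, ?_⟩
      · rw [← hv, ← hσ, isLargestRhombus_closure_iff ha _ h]
        rfl
      · rw [mapAt_concat, shapeAt_concat, hW]
        rfl

lemma gasketStage_eq (ha : a ∈ Ioo (0 : ℝ) 1) (k : ℕ) :
    gasketStage a k =
      {p | ∃ w : List Bool, w.length = k ∧ p ∈ root.mapAt a w '' (root.shapeAt w).region a} := by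
  have key : ∀ w : List Bool, closure (root.mapAt a w '' (root.shapeAt w).base a) =
      root.mapAt a w '' (root.shapeAt w).region a := fun w => by
    obtain ⟨r, σ, h, -⟩ := exists_isSim_root ha w
    rw [h.image_closure, closure_base ha]
  ext p
  simp only [gasketStage, emptyPolygons, sUnion_image, mem_iUnion, mem_emptyRegions_iff ha,
    mem_ofPred_eq]
  constructor
  · rintro ⟨_, ⟨w, hw, rfl⟩, hp⟩
    exact ⟨w, hw, key w ▸ hp⟩
  · rintro ⟨w, hw, hp⟩
    exact ⟨_, ⟨w, hw, rfl⟩, (key w).symm ▸ hp⟩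

lemma isConstructionRhombus_rhombusAt (ha : a ∈ Ioo (0 : ℝ) 1) (w : List Bool) :
    IsConstructionRhombus a (orientationAt (w.length + 1)) (rhombusAt a root w) := by
  obtain ⟨r, σ, h, hσ, -⟩ := exists_isSim_root ha w
  refine .placed w.length _ _ ((mem_emptyRegions_iff ha _ _).2 ⟨w, rfl, rfl⟩) ?_
  rw [← hσ, isLargestRhombus_closure_iff ha _ h]
  rfl

lemma IsConstructionRhombus.eq_or (ha : a ∈ Ioo (0 : ℝ) 1) {o : Orientation} {R : Set Plane}
    (hR : IsConstructionRhombus a o R) :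
    (o = .horizontal ∧ R = initialRhombus a) ∨
      ∃ w : List Bool, o = orientationAt (w.length + 1) ∧ R = rhombusAt a root w := by
  cases hR with
  | initial => exact Or.inl ⟨rfl, rfl⟩
  | placed k U _ hU hR =>
    obtain ⟨w, rfl, rfl⟩ := (mem_emptyRegions_iff ha _ _).1 hU
    obtain ⟨r, σ, h, hσ, -⟩ := exists_isSim_root ha w
    rw [← hσ, isLargestRhombus_closure_iff ha _ h] at hR
    exact Or.inr ⟨w, rfl, hR⟩

/-! ### Contact points in every region -/

/-- This justifies the names of the edges: after `w.length` iterations the opposite edges lie on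
rhombi of the orientation just placed, the same edges on rhombi of the orientation to be placed
next. The induction splits off the last letter of the address. -/
lemma exists_frontier_of_mem_edges (ha : a ∈ Ioo (0 : ℝ) 1) (w : List Bool) (x : Plane) :
    (x ∈ (root.shapeAt w).oppEdges a → ∃ S, IsConstructionRhombus a (orientationAt w.length) S ∧
      root.mapAt a w x ∈ frontier S) ∧
    (x ∈ (root.shapeAt w).sameEdges a →
      ∃ S, IsConstructionRhombus a (orientationAt (w.length + 1)) S ∧
        root.mapAt a w x ∈ frontier S) := by
  induction w using List.reverseRecOn generalizing x with
  | nil =>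
    refine ⟨fun hx => ⟨initialRhombus a, ?_, ?_⟩, fun hx => hx.elim⟩
    · have : orientationAt 0 = .horizontal := by simp [orientationAt]
      rw [List.length_nil, this]
      exact .initial
    · rw [frontier_initialRhombus ha.1]
      exact hx
  | append_singleton w b ih =>
    obtain ⟨r, σ, h, -⟩ := exists_isSim_root ha w
    rw [shapeAt_concat, mapAt_concat, List.length_append, List.length_singleton]
    refine ⟨fun hx => ?_, fun hx => ?_⟩
    · rcases nextMap_oppEdges ha _ b hx with hx | hx
      · exact (ih _).2 hx
      · refine ⟨_, isConstructionRhombus_rhombusAt ha w, ?_⟩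
        rw [rhombusAt, h.image_frontier]
        exact mem_image_of_mem _ hx
    · obtain ⟨S, hS⟩ := (ih _).1 (nextMap_sameEdges ha _ b hx)
      rw [orientationAt_succ, orientationAt_succ, Orientation.opp_opp]
      exact ⟨S, hS⟩

/-- The middle point lies both on the new rhombus and on an opposite edge, hence on an earlier
rhombus of the other orientation; parity decides which of the two is vertical. -/
lemma mapAt_mid_mem_contactPoints (ha : a ∈ Ioo (0 : ℝ) 1) (w : List Bool) :
    root.mapAt a w ((root.shapeAt w).mid a) ∈ contactPoints a := by
  obtain ⟨r, σ, h, -⟩ := exists_isSim_root ha w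
  obtain ⟨S, hS, hS'⟩ := (exists_frontier_of_mem_edges ha w _).1 (mid_mem_oppEdges ha _)
  have hR := isConstructionRhombus_rhombusAt ha w
  have hR' : root.mapAt a w ((root.shapeAt w).mid a) ∈ frontier (rhombusAt a root w) := by
    rw [rhombusAt, h.image_frontier]
    exact mem_image_of_mem _ (mid_mem_frontier ha _)
  rw [orientationAt_succ] at hR
  cases ho : orientationAt w.length <;> rw [ho] at hR hS
  · exact ⟨_, _, hR, hS, hR', hS'⟩
  · exact ⟨_, _, hS, hR, hS', hR'⟩

/-! ### The gasket as a self-similar set -/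

/-- A family of compact sets, one for each shape, satisfying the self-similarity relations of the
construction. -/
structure IsLimitFamily (a : ℝ) (G : Shape → Set Plane) : Prop where
  closed : ∀ t, IsClosed (G t)
  subset : ∀ t, G t ⊆ t.region a
  corners : ∀ t, t.corners a ⊆ G t
  eq : ∀ t, G t = t.nextMap a false '' G (t.next false) ∪ t.nextMap a true '' G (t.next true)

namespace IsLimitFamily

variable {G : Shape → Set Plane}

lemma nextMap_mem (hG : IsLimitFamily a G) (t : Shape) (b : Bool) {x : Plane}
    (hx : x ∈ G (t.next b)) : t.nextMap a b x ∈ G t := by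
  rw [hG.eq]
  cases b
  · exact Or.inl (mem_image_of_mem _ hx)
  · exact Or.inr (mem_image_of_mem _ hx)

lemma mapAt_mem (hG : IsLimitFamily a G) (t : Shape) (w : List Bool) {x : Plane}
    (hx : x ∈ G (t.shapeAt w)) : t.mapAt a w x ∈ G t := by
  induction w generalizing t with
  | nil => exact hx
  | cons b w ih => exact hG.nextMap_mem t b (ih _ hx)

lemma exists_mem (hG : IsLimitFamily a G) (n : ℕ) (t : Shape) {p : Plane} (hp : p ∈ G t) :
    ∃ w : List Bool, w.length = n ∧ p ∈ t.mapAt a w '' G (t.shapeAt w) := by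
  induction n generalizing t p with
  | zero => exact ⟨[], rfl, p, hp, rfl⟩
  | succ n ih =>
    rw [hG.eq] at hp
    have : ∃ b, p ∈ t.nextMap a b '' G (t.next b) := hp.elim (⟨_, ·⟩) (⟨_, ·⟩)
    obtain ⟨b, q, hq, rfl⟩ := this
    obtain ⟨w, hw, x, hx, rfl⟩ := ih _ hq
    exact ⟨b :: w, by simp [hw], x, hx, rfl⟩

lemma mid_mem (hG : IsLimitFamily a G) (t : Shape) : t.mid a ∈ G t := by
  refine hG.corners t ?_
  cases t
  · exact Or.inl rfl
  · exact rfl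
  · exact Or.inl rfl

lemma exists_forall_dist_le (ha : a ∈ Ioo (0 : ℝ) 1) {ε : ℝ} (hε : 0 < ε) :
    -- The gasket intersects only the stages with index at least `1`, hence the lower bound on `n`.
    ∃ n ≥ 1, ∀ w : List Bool, w.length = n → ∀ x ∈ (root.shapeAt w).region a,
      ∀ y ∈ (root.shapeAt w).region a, dist (root.mapAt a w x) (root.mapAt a w y) < ε := by
  have h0 := rate_pos ha
  have hlim : Tendsto (fun n : ℕ => rate a ^ n / rate a ^ 2 * (4 / a)) atTop (𝓝 0) := by
    have := ((tendsto_pow_atTop_nhds_zero_of_lt_one h0.le (rate_lt_one ha)).div_const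
      (rate a ^ 2)).mul_const (4 / a)
    simpa using this
  obtain ⟨n, hn, hn1⟩ := ((hlim.eventually (gt_mem_nhds hε)).and (eventually_ge_atTop 1)).exists
  refine ⟨n, hn1, ?_⟩
  rintro w rfl x hx y hy
  obtain ⟨r, σ, h, -, hr⟩ := exists_isSim_root ha w
  rw [h.dist_map]
  refine lt_of_le_of_lt ?_ hn
  exact mul_le_mul hr (dist_le_of_mem_region ha _ hx hy) dist_nonneg (by positivity)

/-- Unfolding the self-similarity `k` times puts `G root` in stage `k`. Conversely a point of the
gasket lies in arbitrarily small regions, each containing the image of a middle point, which belongs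
to the closed set `G root`. -/
lemma eq_gasket (ha : a ∈ Ioo (0 : ℝ) 1) (hG : IsLimitFamily a G) : G root = gasket a := by
  refine Subset.antisymm (fun p hp => ?_) fun p hp => ?_
  · simp only [gasket, mem_iInter, gasketStage_eq ha]
    intro k _
    obtain ⟨w, hw, x, hx, rfl⟩ := hG.exists_mem k root hp
    exact ⟨w, hw, x, hG.subset _ hx, rfl⟩
  · rw [← (hG.closed root).closure_eq, Metric.mem_closure_iff]
    intro ε hε
    obtain ⟨n, hn, hd⟩ := exists_forall_dist_le ha hε
    simp only [gasket, mem_iInter, gasketStage_eq ha] at hp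
    obtain ⟨w, hw, x, hx, rfl⟩ := hp n hn
    have hm := hG.mid_mem (root.shapeAt w)
    exact ⟨_, hG.mapAt_mem root w hm, hd w hw x hx _ (hG.subset _ hm)⟩

/-- A rhombus at an address of even length has the orientation of the one inscribed in `t`, at odd
length the other one. In both cases the edges in question have the orientation opposite to the
rhombus; descending one letter switches both the parity and the kind of edge, and the induction ends
at a corner. -/
lemma rhombusAt_inter_edges (ha : a ∈ Ioo (0 : ℝ) 1) (hG : IsLimitFamily a G) (w : List Bool)
    (t : Shape) {p : Plane} (hp : p ∈ rhombusAt a t w) :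
    (Even w.length → p ∈ t.oppEdges a → p ∈ G t) ∧
    (¬ Even w.length → p ∈ t.sameEdges a → p ∈ G t) := by
  induction w generalizing t p with
  | nil =>
    refine ⟨fun _ h => hG.corners t (inscribed_inter_oppEdges ha t ⟨?_, h⟩), fun h => by simp at h⟩
    simpa [rhombusAt, mapAt, shapeAt] using hp
  | cons b w ih =>
    obtain ⟨x, hx, rfl⟩ := hp
    have hq := mapAt_mem_region ha (t.next b) w (inscribed_subset ha _ hx)
    have := ih (t.next b) (mem_image_of_mem _ hx)
    simp only [List.length_cons, Nat.even_add_one, not_not]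
    exact ⟨fun hw h => hG.nextMap_mem t b (this.2 hw (sameEdges_of_oppEdges ha t b hq h)),
      fun hw h => hG.nextMap_mem t b (this.1 hw (oppEdges_of_sameEdges ha t b hq h))⟩

/-- A common first letter is peeled off. If one address ends, its rhombus bounds a subregion
containing the other along opposite edges (`key`); if the addresses diverge, the rhombi can meet
only where the two subregions do (`hcross`). -/
lemma rhombusAt_inter_rhombusAt (ha : a ∈ Ioo (0 : ℝ) 1) (hG : IsLimitFamily a G)
    (w v : List Bool) (t : Shape) {p : Plane} (hw : p ∈ rhombusAt a t w)
    (hv : p ∈ rhombusAt a t v) (hne : ¬ (Even w.length ↔ Even v.length)) : p ∈ G t := by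
  have key : ∀ (b : Bool) (v : List Bool) (t : Shape) (p : Plane), p ∈ t.inscribed a →
      p ∈ rhombusAt a t (b :: v) → Even v.length → p ∈ G t := by
    rintro b v t _ h1 ⟨x, hx, rfl⟩ hv
    have hq := mapAt_mem_region ha (t.next b) v (inscribed_subset ha _ hx)
    exact hG.nextMap_mem t b ((hG.rhombusAt_inter_edges ha v (t.next b)
      (mem_image_of_mem _ hx)).1 hv (oppEdges_of_inscribed ha t b hq h1))
  have hcross : ∀ (v v' : List Bool) (t : Shape) (p : Plane), p ∈ rhombusAt a t (false :: v) →
      p ∈ rhombusAt a t (true :: v') → p ∈ G t := by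
    rintro v v' t p ⟨x, hx, rfl⟩ ⟨y, hy, hxy⟩
    have hqx := mapAt_mem_region ha (t.next false) v (inscribed_subset ha _ hx)
    have hqy := mapAt_mem_region ha (t.next true) v' (inscribed_subset ha _ hy)
    rcases eq_corner_of_nextMap_eq ha t hqx hqy hxy.symm with h | ⟨rfl, h⟩
    · have := hG.mid_mem t
      rwa [← h] at this
    · refine hG.corners root (Or.inr ?_)
      exact h
  induction w generalizing v t p with
  | nil =>
    cases v with
    | nil => simp at hne
    | cons b v =>
      refine key b v t p (by simpa [rhombusAt, mapAt, shapeAt] using hw) hv ?_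
      simpa [Nat.even_add_one] using hne
  | cons b w ih =>
    cases v with
    | nil =>
      refine key b w t p (by simpa [rhombusAt, mapAt, shapeAt] using hv) hw ?_
      simpa [Nat.even_add_one] using hne
    | cons c v =>
      by_cases hbc : b = c
      · subst hbc
        obtain ⟨x, hx, rfl⟩ := hw
        obtain ⟨y, hy, hxy⟩ := hv
        obtain ⟨r, σ, h, -⟩ := exists_isSim_nextMap_le ha t b
        have hxy' := h.injective hxy
        refine hG.nextMap_mem t b (ih v (t.next b) (mem_image_of_mem _ hx) ?_ ?_)
        · rw [← hxy']; exact mem_image_of_mem _ hy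
        · rwa [List.length_cons, List.length_cons, Nat.even_add_one, Nat.even_add_one,
            not_iff_not] at hne
      · cases b <;> cases c
        · exact absurd rfl hbc
        · exact hcross w v t p hw hv
        · exact hcross v w t p hv hw
        · exact absurd rfl hbc

lemma contactPoints_subset (ha : a ∈ Ioo (0 : ℝ) 1) (hG : IsLimitFamily a G) :
    contactPoints a ⊆ G root := by
  rintro p ⟨V, H, hV, hH, hpV, hpH⟩
  have hcl : ∀ w, IsClosed (rhombusAt a root w) := fun w => by
    obtain ⟨r, σ, h, -⟩ := exists_isSim_root ha w
    rw [rhombusAt, inscribed, h.image_rhombus]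
    exact isClosed_rhombus _ _ _ _
  obtain ⟨⟨⟩, -⟩ | ⟨w, hw, rfl⟩ := hV.eq_or ha
  -- The rhombus at address `w` is placed at iteration `w.length + 1`, so vertical rhombi have
  -- addresses of even length.
  have hwe : Even w.length := by
    by_contra h
    simp [orientationAt, Nat.odd_add_one, Nat.not_odd_iff_even, h] at hw
  have hpw := (hcl w).frontier_subset hpV
  obtain ⟨-, rfl⟩ | ⟨v, hv, rfl⟩ := hH.eq_or ha
  · rw [frontier_initialRhombus ha.1] at hpH
    exact (hG.rhombusAt_inter_edges ha w root hpw).1 hwe hpH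
  · refine hG.rhombusAt_inter_rhombusAt ha w v root hpw ((hcl v).frontier_subset hpH) ?_
    intro h
    have hve := h.1 hwe
    simp [orientationAt, hve] at hv

lemma gasket_eq_closure (ha : a ∈ Ioo (0 : ℝ) 1) (hG : IsLimitFamily a G) :
    gasket a = closure (contactPoints a) := by
  refine Subset.antisymm (fun p hp => ?_) ?_
  · rw [Metric.mem_closure_iff]
    intro ε hε
    obtain ⟨n, hn, hd⟩ := exists_forall_dist_le ha hε
    simp only [gasket, mem_iInter, gasketStage_eq ha] at hp
    obtain ⟨w, hw, x, hx, rfl⟩ := hp n hn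
    exact ⟨_, mapAt_mid_mem_contactPoints ha w, hd w hw x hx _ (hG.subset _ (hG.mid_mem _))⟩
  · rw [← hG.eq_gasket ha]
    exact closure_minimal (hG.contactPoints_subset ha) (hG.closed root)

end IsLimitFamily

/-! ### Concatenation of paths -/

/-- Concatenation of two curves parametrized by `[0, 1]`. -/
def concat (f g : ℝ → Plane) (t : ℝ) : Plane := if t ≤ 1 / 2 then f (2 * t) else g (2 * t - 1)

section concat

variable {f g f' g' : ℝ → Plane}

lemma concat_cases {p : Plane → Prop} {t : ℝ} (ht : t ∈ Icc (0 : ℝ) 1)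
    (hf : ∀ s ∈ Icc (0 : ℝ) 1, p (f s)) (hg : ∀ s ∈ Icc (0 : ℝ) 1, p (g s)) :
    p (concat f g t) := by
  unfold concat
  split_ifs with h
  · exact hf _ ⟨by linarith [ht.1], by linarith⟩
  · exact hg _ ⟨by linarith, by linarith [ht.2]⟩

@[simp] lemma concat_zero : concat f g 0 = f 0 := by simp [concat]

@[simp] lemma concat_one : concat f g 1 = g 1 := by norm_num [concat]

lemma concat_image (h : f 1 = g 0) :
    concat f g '' Icc 0 1 = f '' Icc 0 1 ∪ g '' Icc 0 1 := by
  refine Subset.antisymm ?_ (union_subset ?_ ?_)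
  · rintro _ ⟨t, ht, rfl⟩
    exact concat_cases (p := (· ∈ f '' Icc 0 1 ∪ g '' Icc 0 1)) ht
      (fun s hs => Or.inl ⟨s, hs, rfl⟩) (fun s hs => Or.inr ⟨s, hs, rfl⟩)
  · rintro _ ⟨s, hs, rfl⟩
    refine ⟨s / 2, ⟨by linarith [hs.1], by linarith [hs.2]⟩, ?_⟩
    rw [concat, if_pos (by linarith [hs.2])]
    congr 1; ring
  · rintro _ ⟨s, hs, rfl⟩
    rcases hs.1.eq_or_lt with h0 | h0
    · subst h0
      refine ⟨1 / 2, by norm_num, ?_⟩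
      rw [concat, if_pos le_rfl, ← h]
      norm_num
    · refine ⟨(s + 1) / 2, ⟨by linarith [hs.1], by linarith [hs.2]⟩, ?_⟩
      rw [concat, if_neg (by linarith)]
      congr 1; ring

lemma dist_concat_le {D : ℝ} (hf : ∀ s ∈ Icc (0 : ℝ) 1, dist (f s) (f' s) ≤ D)
    (hg : ∀ s ∈ Icc (0 : ℝ) 1, dist (g s) (g' s) ≤ D) :
    ∀ t ∈ Icc (0 : ℝ) 1, dist (concat f g t) (concat f' g' t) ≤ D := by
  intro t ht
  unfold concat
  split_ifs with h
  · exact hf _ ⟨by linarith [ht.1], by linarith⟩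
  · exact hg _ ⟨by linarith, by linarith [ht.2]⟩

lemma tendsto_concat {F H : ℕ → ℝ → Plane}
    (hf : ∀ s ∈ Icc (0 : ℝ) 1, Tendsto (fun n => F n s) atTop (𝓝 (f s)))
    (hg : ∀ s ∈ Icc (0 : ℝ) 1, Tendsto (fun n => H n s) atTop (𝓝 (g s))) :
    ∀ t ∈ Icc (0 : ℝ) 1, Tendsto (fun n => concat (F n) (H n) t) atTop (𝓝 (concat f g t)) := by
  intro t ht
  unfold concat
  split_ifs with h
  · exact hf _ ⟨by linarith [ht.1], by linarith⟩
  · exact hg _ ⟨by linarith, by linarith [ht.2]⟩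

lemma continuous_concat {F H : ℝ → ℝ → Plane} (hF : Continuous fun x : ℝ × ℝ => F x.1 x.2)
    (hH : Continuous fun x : ℝ × ℝ => H x.1 x.2) (h : ∀ a, F a 1 = H a 0) :
    Continuous fun x : ℝ × ℝ => concat (F x.1) (H x.1) x.2 := by
  unfold concat
  refine Continuous.if_le ?_ ?_ (by fun_prop) continuous_const ?_
  · exact hF.comp (f := fun x : ℝ × ℝ => (x.1, 2 * x.2)) (by fun_prop)
  · exact hH.comp (f := fun x : ℝ × ℝ => (x.1, 2 * x.2 - 1)) (by fun_prop)
  · intro x hx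
    rw [hx]
    norm_num [h]

/-- `f` takes equal values on `[0, 1]` only at parameters of distance at most `ε`. -/
def InjUpTo (ε : ℝ) (f : ℝ → Plane) : Prop :=
  ∀ s ∈ Icc (0 : ℝ) 1, ∀ t ∈ Icc (0 : ℝ) 1, f s = f t → |s - t| ≤ ε

/-- Each curve is run at double speed, which halves parameter distances, and the two halves meet
only at the junction. -/
lemma InjUpTo.concat {ε : ℝ} (hf : InjUpTo ε f) (hg : InjUpTo ε g)
    (h : ∀ s ∈ Icc (0 : ℝ) 1, ∀ t ∈ Icc (0 : ℝ) 1, f s = g t → s = 1 ∧ t = 0) :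
    InjUpTo (ε / 2) (concat f g) := by
  intro s hs t ht hst
  unfold Gasket.concat at hst
  split_ifs at hst with h1 h2 h2
  · have := hf _ ⟨by linarith [hs.1], by linarith⟩ _ ⟨by linarith [ht.1], by linarith⟩ hst
    rw [← mul_sub, abs_mul, abs_two] at this
    linarith
  · have := h _ ⟨by linarith [hs.1], by linarith⟩ _ ⟨by linarith [ht.1], by linarith [ht.2]⟩ hst
    linarith
  · have := h _ ⟨by linarith [ht.1], by linarith⟩ _ ⟨by linarith, by linarith [hs.2]⟩ hst.symm
    linarith
  · have := hg _ ⟨by linarith [hs.1], by linarith [hs.2]⟩ _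
      ⟨by linarith [ht.1], by linarith [ht.2]⟩ hst
    rw [sub_sub_sub_cancel_right, ← mul_sub, abs_mul, abs_two] at this
    linarith

end concat

lemma one_sub_mem {t : ℝ} (ht : t ∈ Icc (0 : ℝ) 1) : 1 - t ∈ Icc (0 : ℝ) 1 :=
  ⟨by linarith [ht.2], by linarith [ht.1]⟩

lemma InjUpTo.comp_one_sub {ε : ℝ} {f : ℝ → Plane} (hf : InjUpTo ε f) {φ : Plane → Plane}
    (hφ : Function.Injective φ) : InjUpTo ε fun t => φ (f (1 - t)) := by
  intro s hs t ht h
  have := hf _ (one_sub_mem hs) _ (one_sub_mem ht) (hφ h)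
  rwa [sub_sub_sub_cancel_left, abs_sub_comm] at this

lemma image_comp_one_sub (f : ℝ → Plane) (φ : Plane → Plane) :
    (fun t => φ (f (1 - t))) '' Icc 0 1 = φ '' (f '' Icc 0 1) := by
  rw [image_image]
  refine Subset.antisymm ?_ ?_
  · rintro _ ⟨t, ht, rfl⟩
    exact ⟨_, one_sub_mem ht, rfl⟩
  · rintro _ ⟨t, ht, rfl⟩
    exact ⟨_, one_sub_mem ht, by simp⟩

/-! ### Approximating polygons -/

/-- The curve through a dart made from a curve through a triangle. -/
def dartCurve (g : ℝ → Plane) : ℝ → Plane := concat g fun t => flipY (g (1 - t))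

/-- The closed curve made from a curve through a triangle. -/
def rootCurve (g : ℝ → Plane) : ℝ → Plane :=
  concat (dartCurve g) fun t => flipX (dartCurve g (1 - t))

/-- The refinement of a curve through the standard triangle. -/
def refinement (a : ℝ) (g : ℝ → Plane) : ℝ → Plane :=
  concat (fun t => tipMap a (g t)) fun t => sideMap a (dartCurve g t)

/-- The successive polygonal approximations of the limit curve in the standard triangle. -/
def polygon (a : ℝ) : ℕ → ℝ → Plane
  | 0 => fun t => !₂[a * t, 1 - t]
  | n + 1 => refinement a (polygon a n)

/-- Curves through the standard triangle with the right end points. -/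
structure IsTriCurve (a : ℝ) (g : ℝ → Plane) : Prop where
  mem : ∀ t ∈ Icc (0 : ℝ) 1, g t ∈ Shape.tri.region a
  zero : g 0 = !₂[0, 1]
  one : g 1 = !₂[a, 0]

variable {a : ℝ}

open Shape

lemma flipY_dart_zero : flipY !₂[0, 1] = !₂[0, -1] := plane_ext (by simp) (by simp)

lemma flipY_tri_one (a : ℝ) : flipY !₂[a, 0] = !₂[a, 0] := plane_ext (by simp) (by simp)

lemma flipX_dart_zero : flipX !₂[0, 1] = !₂[0, 1] := plane_ext (by simp) (by simp)

lemma flipX_dart_one : flipX !₂[0, -1] = !₂[0, -1] := plane_ext (by simp) (by simp)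

lemma tipMap_tri_zero (a : ℝ) : tipMap a !₂[0, 1] = !₂[0, 1] := plane_ext (by simp) (by simp)

lemma tipMap_tri_one (a : ℝ) : tipMap a !₂[a, 0] = !₂[a, 1 - a ^ 2] :=
  plane_ext (by simp) (by simp; ring)

lemma sideMap_dart_zero (a : ℝ) : sideMap a !₂[0, 1] = !₂[a, 1 - a ^ 2] :=
  plane_ext (by simp) (by simp [halfHeight])

lemma sideMap_dart_one (a : ℝ) : sideMap a !₂[0, -1] = !₂[a, 0] :=
  plane_ext (by simp) (by simp)

/-- The end points match for every real `a`, so the approximations are continuous on all of `ℝ × ℝ`,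
and the restriction to `(0, 1)` is needed only for convergence. -/
lemma polygon_ends (a : ℝ) (n : ℕ) : polygon a n 0 = !₂[0, 1] ∧ polygon a n 1 = !₂[a, 0] := by
  induction n with
  | zero => exact ⟨plane_ext (by simp [polygon]) (by simp [polygon]),
      plane_ext (by simp [polygon]) (by simp [polygon])⟩
  | succ n ih =>
    simp only [polygon, refinement, dartCurve, concat_zero, concat_one, sub_self, ih.1,
      tipMap_tri_zero, flipY_dart_zero, sideMap_dart_one, and_self]

lemma continuous_dartCurve {F : ℝ → ℝ → Plane} (hF : Continuous fun x : ℝ × ℝ => F x.1 x.2)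
    (h1 : ∀ a, F a 1 = !₂[a, 0]) : Continuous fun x : ℝ × ℝ => dartCurve (F x.1) x.2 := by
  refine continuous_concat (H := fun a t => flipY (F a (1 - t))) hF ?_ ?_
  -- Reflections respect rhombi of every aspect ratio; the value `0` is arbitrary.
  · exact (isSim_flipY 0).continuous.comp
      (hF.comp (f := fun x : ℝ × ℝ => (x.1, 1 - x.2)) (by fun_prop))
  · intro a
    simp only [sub_zero, h1, flipY_tri_one]

lemma continuous_rootCurve {F : ℝ → ℝ → Plane} (hF : Continuous fun x : ℝ × ℝ => F x.1 x.2)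
    (h0 : ∀ a, F a 0 = !₂[0, 1]) (h1 : ∀ a, F a 1 = !₂[a, 0]) :
    Continuous fun x : ℝ × ℝ => rootCurve (F x.1) x.2 := by
  have hd := continuous_dartCurve hF h1
  refine continuous_concat (F := fun a => dartCurve (F a))
    (H := fun a t => flipX (dartCurve (F a) (1 - t))) hd ?_ ?_
  · exact (isSim_flipX 0).continuous.comp
      (hd.comp (f := fun x : ℝ × ℝ => (x.1, 1 - x.2)) (by fun_prop))
  · intro a
    simp only [dartCurve, concat_one, sub_self, sub_zero, h0, flipY_dart_zero, flipX_dart_one]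

lemma continuous_polygon (n : ℕ) : Continuous fun x : ℝ × ℝ => polygon x.1 n x.2 := by
  induction n with
  | zero => exact continuous_mk (by fun_prop) (by fun_prop)
  | succ n ih =>
    have hd := continuous_dartCurve (F := fun a => polygon a n) ih fun a => (polygon_ends a n).2
    refine continuous_concat (F := fun a t => tipMap a (polygon a n t))
      (H := fun a t => sideMap a (dartCurve (polygon a n) t)) ?_ ?_ ?_
    · refine continuous_mk ?_ ?_
      · exact continuous_fst.mul (continuous_const.sub
          ((by fun_prop : Continuous fun p : Plane => p 1).comp ih))
      · exact continuous_const.sub (continuous_fst.mul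
          ((by fun_prop : Continuous fun p : Plane => p 0).comp ih))
    · unfold sideMap halfHeight
      refine continuous_mk ?_ ?_
      · exact continuous_fst.add ((by fun_prop : Continuous fun x : ℝ × ℝ => (1 - x.1 ^ 2) / 2).mul
          ((by fun_prop : Continuous fun p : Plane => p 0).comp hd))
      · exact (by fun_prop : Continuous fun x : ℝ × ℝ => (1 - x.1 ^ 2) / 2).add
          ((by fun_prop : Continuous fun x : ℝ × ℝ => (1 - x.1 ^ 2) / 2).mul
          ((by fun_prop : Continuous fun p : Plane => p 1).comp hd))
    · intro a
      simp only [dartCurve, concat_zero, (polygon_ends a n).1, (polygon_ends a n).2,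
        sideMap_dart_zero, tipMap_tri_one]

lemma dartCurve_mem (ha : a ∈ Ioo (0 : ℝ) 1) {g : ℝ → Plane}
    (hg : ∀ t ∈ Icc (0 : ℝ) 1, g t ∈ tri.region a) :
    ∀ t ∈ Icc (0 : ℝ) 1, dartCurve g t ∈ dart.region a := fun _ ht =>
  concat_cases (p := (· ∈ dart.region a)) ht
    (fun s hs => nextMap_mem_region ha dart false (hg s hs))
    (fun _ hs => nextMap_mem_region ha dart true (hg _ (one_sub_mem hs)))

lemma polygon_mem (ha : a ∈ Ioo (0 : ℝ) 1) (n : ℕ) :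
    ∀ t ∈ Icc (0 : ℝ) 1, polygon a n t ∈ tri.region a := by
  induction n with
  | zero =>
    intro t ht
    have h0 := ha.1
    have h1 := ha.2
    have h2 : 0 ≤ (1 - a ^ 2) * t := mul_nonneg (by nlinarith) ht.1
    have h3 : a ^ 2 * t ≤ a ^ 2 * 1 := mul_le_mul_of_nonneg_left ht.2 (by positivity)
    refine ⟨?_, ?_, ?_⟩ <;>
      simp only [polygon, Matrix.cons_val_zero, Matrix.cons_val_one]
    · linarith
    · linarith
    · linarith [ht.2]
  | succ n ih =>
    intro t ht
    exact concat_cases (p := (· ∈ tri.region a)) ht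
      (fun s hs => nextMap_mem_region ha tri false (ih s hs))
      (fun s hs => nextMap_mem_region ha tri true (dartCurve_mem ha ih s hs))

lemma dist_dartCurve_le {f g : ℝ → Plane} {D : ℝ}
    (h : ∀ t ∈ Icc (0 : ℝ) 1, dist (f t) (g t) ≤ D) :
    ∀ t ∈ Icc (0 : ℝ) 1, dist (dartCurve f t) (dartCurve g t) ≤ D :=
  dist_concat_le h fun s hs => by
    rw [(isSim_flipY 0).dist_map, one_mul]
    exact h _ (one_sub_mem hs)

lemma dist_rootCurve_le {f g : ℝ → Plane} {D : ℝ}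
    (h : ∀ t ∈ Icc (0 : ℝ) 1, dist (f t) (g t) ≤ D) :
    ∀ t ∈ Icc (0 : ℝ) 1, dist (rootCurve f t) (rootCurve g t) ≤ D :=
  dist_concat_le (dist_dartCurve_le h) fun s hs => by
    rw [(isSim_flipX 0).dist_map, one_mul]
    exact dist_dartCurve_le h _ (one_sub_mem hs)

lemma dist_refinement_le (ha : a ∈ Ioo (0 : ℝ) 1) {f g : ℝ → Plane} {D L : ℝ} (hD : 0 ≤ D)
    (hL : max a (halfHeight a) ≤ L)
    (h : ∀ t ∈ Icc (0 : ℝ) 1, dist (f t) (g t) ≤ D) :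
    ∀ t ∈ Icc (0 : ℝ) 1, dist (refinement a f t) (refinement a g t) ≤ D * L :=
  dist_concat_le
    (fun s hs => by
      rw [(isSim_tipMap ha).dist_map, mul_comm]
      exact mul_le_mul (h s hs) ((le_max_left _ _).trans hL) ha.1.le hD)
    (fun s hs => by
      rw [(isSim_sideMap ha).dist_map, mul_comm]
      exact mul_le_mul (dist_dartCurve_le h s hs) ((le_max_right _ _).trans hL)
        (halfHeight_pos ha).le hD)

lemma dist_polygon_succ_le (ha : a ∈ Ioo (0 : ℝ) 1) {C L : ℝ} (hC : 4 / a ≤ C)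
    (hL : max a (halfHeight a) ≤ L) (n : ℕ) :
    ∀ t ∈ Icc (0 : ℝ) 1, dist (polygon a n t) (polygon a (n + 1) t) ≤ C * L ^ n := by
  have hL0 : 0 ≤ L := (ha.1.le.trans (le_max_left _ _)).trans hL
  have hC0 : 0 ≤ C := (div_nonneg (by norm_num) ha.1.le).trans hC
  induction n with
  | zero =>
    intro t ht
    rw [pow_zero, mul_one]
    exact (dist_le_of_mem_region ha tri (polygon_mem ha 0 t ht) (polygon_mem ha 1 t ht)).trans hC
  | succ n ih =>
    rw [pow_succ, ← mul_assoc]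
    exact dist_refinement_le ha (by positivity) hL ih

/-! ### The limit curve -/

/-- The limit curve in the standard triangle. -/
def curve (a t : ℝ) : Plane := limUnder atTop fun n => polygon a n t

lemma max_lt_one (ha : a ∈ Ioo (0 : ℝ) 1) : max a (halfHeight a) < 1 :=
  max_lt ha.2 (by unfold halfHeight; nlinarith [ha.1])

lemma tendsto_polygon (ha : a ∈ Ioo (0 : ℝ) 1) :
    ∀ t ∈ Icc (0 : ℝ) 1, Tendsto (fun n => polygon a n t) atTop (𝓝 (curve a t)) := fun t ht =>
  (cauchySeq_of_le_geometric _ _ (max_lt_one ha) fun n =>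
    dist_polygon_succ_le ha le_rfl le_rfl n t ht).tendsto_limUnder

lemma dist_polygon_curve_le (ha : a ∈ Ioo (0 : ℝ) 1) {C L : ℝ} (hC : 4 / a ≤ C)
    (hL : max a (halfHeight a) ≤ L) (hL1 : L < 1) (n : ℕ) :
    ∀ t ∈ Icc (0 : ℝ) 1, dist (polygon a n t) (curve a t) ≤ C * L ^ n / (1 - L) := fun t ht =>
  dist_le_of_le_geometric_of_tendsto _ _ hL1
    (fun n => dist_polygon_succ_le ha hC hL n t ht) (tendsto_polygon ha t ht) n

/-- For `a` in `(δ, 1 - δ)` both the diameter bound and the contraction ratio are uniform, so the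
polygons converge uniformly there and the limit is jointly continuous. The nonexpansive operator `Φ`
allows one argument for both `curve` and `rootCurve`. -/
lemma continuousOn_of_polygon_limit (Φ : (ℝ → Plane) → ℝ → Plane)
    (hΦ : ∀ f g D, (∀ t ∈ Icc (0 : ℝ) 1, dist (f t) (g t) ≤ D) →
      ∀ t ∈ Icc (0 : ℝ) 1, dist (Φ f t) (Φ g t) ≤ D)
    (hc : ∀ n, Continuous fun x : ℝ × ℝ => Φ (polygon x.1 n) x.2) :
    ContinuousOn (fun x : ℝ × ℝ => Φ (curve x.1) x.2) (Ioo (0 : ℝ) 1 ×ˢ Icc (0 : ℝ) 1) := by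
  have key : ∀ δ ∈ Ioo (0 : ℝ) 1, ContinuousOn (fun x : ℝ × ℝ => Φ (curve x.1) x.2)
      (Ioo δ (1 - δ) ×ˢ Icc (0 : ℝ) 1) := by
    intro δ hδ
    obtain ⟨L, hL1, hL⟩ : ∃ L < 1, ∀ a ∈ Ioo δ (1 - δ), max a (halfHeight a) ≤ L := by
      -- The two entries bound the two ratios: `a < 1 - δ` and `halfHeight a ≤ 1 / 2`.
      refine ⟨max (1 - δ) (1 / 2), max_lt (by linarith [hδ.1]) (by norm_num), fun a ha => ?_⟩
      refine max_le_max ha.2.le ?_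
      unfold halfHeight
      linarith [sq_nonneg a]
    have hlim : Tendsto (fun n : ℕ => 4 / δ * max L 0 ^ n / (1 - max L 0)) atTop (𝓝 0) := by
      have := ((tendsto_pow_atTop_nhds_zero_of_lt_one (le_max_right L 0)
        (max_lt hL1 one_pos)).const_mul (4 / δ)).div_const (1 - max L 0)
      simpa using this
    refine TendstoUniformlyOn.continuousOn (F := fun n (x : ℝ × ℝ) => Φ (polygon x.1 n) x.2)
      (p := atTop) ?_ (Frequently.of_forall fun n => (hc n).continuousOn)
    rw [Metric.tendstoUniformlyOn_iff]
    intro ε hε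
    filter_upwards [hlim.eventually (gt_mem_nhds hε)] with n hn x hx
    have hx1 := hx.1
    have ha : x.1 ∈ Ioo (0 : ℝ) 1 := ⟨hδ.1.trans hx1.1, by linarith [hx1.2, hδ.1]⟩
    rw [dist_comm]
    refine (hΦ _ _ _ ?_ x.2 hx.2).trans_lt hn
    exact dist_polygon_curve_le ha (div_le_div_of_nonneg_left (by norm_num) hδ.1 hx1.1.le)
      ((hL _ hx1).trans (le_max_left _ _)) (max_lt hL1 one_pos) n
  intro x hx
  have hx1 := hx.1
  obtain ⟨δ, hδ0, hδ⟩ := exists_between (lt_min hx1.1 (sub_pos.2 hx1.2))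
  have h1 := hδ.trans_le (min_le_left _ _)
  have h2 := hδ.trans_le (min_le_right _ _)
  have hxδ : x.1 ∈ Ioo δ (1 - δ) := ⟨h1, by linarith⟩
  refine (key δ ⟨hδ0, h1.trans hx1.2⟩ x ⟨hxδ, hx.2⟩).mono_of_mem_nhdsWithin ?_
  have : Ioo δ (1 - δ) ×ˢ univ ∈ 𝓝 x := prod_mem_nhds (Ioo_mem_nhds hxδ.1 hxδ.2) univ_mem
  filter_upwards [mem_nhdsWithin_of_mem_nhds this, self_mem_nhdsWithin] with y hy hy'
  exact ⟨hy.1, hy'.2⟩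

lemma continuousOn_curve (ha : a ∈ Ioo (0 : ℝ) 1) : ContinuousOn (curve a) (Icc 0 1) :=
  (continuousOn_of_polygon_limit id (fun _ _ _ h => h) continuous_polygon).comp
    (f := fun t : ℝ => (a, t)) (by fun_prop) fun _ ht => ⟨ha, ht⟩

lemma continuousOn_rootCurve : ContinuousOn (fun x : ℝ × ℝ => rootCurve (curve x.1) x.2)
    (Ioo (0 : ℝ) 1 ×ˢ Icc (0 : ℝ) 1) :=
  continuousOn_of_polygon_limit rootCurve (fun _ _ _ => dist_rootCurve_le) fun n =>
    continuous_rootCurve (F := fun a => polygon a n) (continuous_polygon n)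
      (fun a => (polygon_ends a n).1) fun a => (polygon_ends a n).2

lemma isTriCurve_curve (ha : a ∈ Ioo (0 : ℝ) 1) : IsTriCurve a (curve a) where
  mem t ht := (isClosed_region tri).mem_of_tendsto (tendsto_polygon ha t ht)
    (Eventually.of_forall fun n => polygon_mem ha n t ht)
  zero := tendsto_nhds_unique (tendsto_polygon ha 0 (by simp))
    (by simp only [(polygon_ends a _).1, tendsto_const_nhds])
  one := tendsto_nhds_unique (tendsto_polygon ha 1 (by simp))
    (by simp only [(polygon_ends a _).2, tendsto_const_nhds])

/-- The limit is a fixed point of the refinement: pass to the limit in the recursion, all maps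
involved being continuous. -/
lemma refinement_curve (ha : a ∈ Ioo (0 : ℝ) 1) :
    EqOn (curve a) (refinement a (curve a)) (Icc 0 1) := by
  intro t ht
  have hp := tendsto_polygon ha
  have hd := tendsto_concat hp fun s hs =>
    ((isSim_flipY 0).continuous.tendsto _).comp (hp _ (one_sub_mem hs))
  refine tendsto_nhds_unique ((hp t ht).comp (tendsto_add_atTop_nat 1)) ?_
  exact tendsto_concat
    (fun s hs => ((isSim_tipMap ha).continuous.tendsto _).comp (hp s hs))
    (fun s hs => ((isSim_sideMap ha).continuous.tendsto _).comp (hd s hs)) t ht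

/-! ### Injectivity -/

/-- The point `(0, 1)` is fixed by `tipMap` and is not in the dart part, so a parameter `t` reaching
it can be replaced by `2 * t`, again in `[0, 1]`; repeating this gives `t ≤ (1 / 2) ^ n` for all
`n`. The other end point statements reduce to this one. -/
lemma curve_eq_zero (ha : a ∈ Ioo (0 : ℝ) 1) {t : ℝ} (ht : t ∈ Icc (0 : ℝ) 1)
    (h : curve a t = !₂[0, 1]) : t = 0 := by
  have hc := isTriCurve_curve ha
  have key : ∀ n : ℕ, ∀ t ∈ Icc (0 : ℝ) 1, curve a t = !₂[0, 1] → t ≤ (1 / 2) ^ n := by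
    intro n
    induction n with
    | zero => exact fun t ht _ => by simpa using ht.2
    | succ n ih =>
      intro t ht h
      rw [refinement_curve ha ht, refinement, concat] at h
      split_ifs at h with h1
      · have := ih _ ⟨by linarith [ht.1], by linarith⟩
          ((isSim_tipMap ha).injective (h.trans (tipMap_tri_zero a).symm))
        rw [pow_succ]
        linarith
      · have h2 := (dart_bounds ha (dartCurve_mem ha hc.mem (2 * t - 1)
          ⟨by linarith, by linarith [ht.2]⟩)).1
        have h3 : a + halfHeight a * dartCurve (curve a) (2 * t - 1) 0 = 0 :=
          congrArg (fun p : Plane => p 0) h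
        linarith [mul_nonneg (halfHeight_pos ha).le h2, ha.1]
  refine le_antisymm (ge_of_tendsto' (tendsto_pow_atTop_nhds_zero_of_lt_one
    (by norm_num : (0 : ℝ) ≤ 1 / 2) (by norm_num)) fun n => key n t ht h) ht.1

lemma dartCurve_eq_zero (ha : a ∈ Ioo (0 : ℝ) 1) {t : ℝ} (ht : t ∈ Icc (0 : ℝ) 1)
    (h : dartCurve (curve a) t = !₂[0, 1]) : t = 0 := by
  have hc := isTriCurve_curve ha
  rw [dartCurve, concat] at h
  split_ifs at h with h1
  · have := curve_eq_zero ha ⟨by linarith [ht.1], by linarith⟩ h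
    linarith
  · have h2 := (tri_bounds ha (hc.mem (1 - (2 * t - 1)) ⟨by linarith [ht.2], by linarith⟩)).2.1
    have h3 : -curve a (1 - (2 * t - 1)) 1 = 1 := congrArg (fun p : Plane => p 1) h
    linarith

lemma dartCurve_eq_one (ha : a ∈ Ioo (0 : ℝ) 1) {t : ℝ} (ht : t ∈ Icc (0 : ℝ) 1)
    (h : dartCurve (curve a) t = !₂[0, -1]) : t = 1 := by
  have hc := isTriCurve_curve ha
  rw [dartCurve, concat] at h
  split_ifs at h with h1
  · have h2 := (tri_bounds ha (hc.mem (2 * t) ⟨by linarith [ht.1], by linarith⟩)).2.1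
    have h3 : curve a (2 * t) 1 = -1 := congrArg (fun p : Plane => p 1) h
    linarith
  · rw [← flipY_dart_zero] at h
    have := curve_eq_zero ha ⟨by linarith [ht.2], by linarith⟩ ((isSim_flipY a).injective h)
    linarith

lemma curve_eq_one (ha : a ∈ Ioo (0 : ℝ) 1) {t : ℝ} (ht : t ∈ Icc (0 : ℝ) 1)
    (h : curve a t = !₂[a, 0]) : t = 1 := by
  have hc := isTriCurve_curve ha
  rw [refinement_curve ha ht, refinement, concat] at h
  split_ifs at h with h1
  -- The tip part misses `(a, 0)`: a preimage would satisfy `a * x = 1` and `y = 0`, against `a * x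
  -- - y ≤ a ^ 2 < 1`.
  · have h2 := (hc.mem (2 * t) ⟨by linarith [ht.1], by linarith⟩).2.2
    have h3 : a * (1 - curve a (2 * t) 1) = a := congrArg (fun p : Plane => p 0) h
    have h4 : 1 - a * curve a (2 * t) 0 = 0 := congrArg (fun p : Plane => p 1) h
    have h5 : a * curve a (2 * t) 1 = 0 := by linarith
    have h6 := (mul_eq_zero.1 h5).resolve_left ha.1.ne'
    nlinarith [ha.1, ha.2]
  · rw [← sideMap_dart_one] at h
    have := dartCurve_eq_one ha ⟨by linarith, by linarith [ht.2]⟩ ((isSim_sideMap ha).injective h)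
    linarith

lemma InjUpTo.dartCurve (ha : a ∈ Ioo (0 : ℝ) 1) {ε : ℝ} (h : InjUpTo ε (curve a)) :
    InjUpTo (ε / 2) (dartCurve (curve a)) := by
  have hc := isTriCurve_curve ha
  refine h.concat (h.comp_one_sub (isSim_flipY a).injective) fun s hs t ht hst => ?_
  obtain h1 | ⟨⟨⟩, -⟩ := eq_corner_of_nextMap_eq ha dart (hc.mem s hs)
    (hc.mem _ (one_sub_mem ht)) hst
  have h1 : curve a s = !₂[a, 0] := h1
  refine ⟨curve_eq_one ha hs h1, ?_⟩
  rw [h1, ← flipY_tri_one] at hst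
  linarith [curve_eq_one ha (one_sub_mem ht) ((isSim_flipY a).injective hst).symm]

/-- The curve is a concatenation of copies of itself, so `InjUpTo.concat` applies. The two parts lie
in subregions meeting only in the middle point, which each part reaches only at its junction end. -/
lemma InjUpTo.curve_half (ha : a ∈ Ioo (0 : ℝ) 1) {ε : ℝ} (hε : 0 ≤ ε)
    (h : InjUpTo ε (curve a)) : InjUpTo (ε / 2) (curve a) := by
  have hc := isTriCurve_curve ha
  have hd := h.dartCurve ha
  have : InjUpTo (ε / 2) (refinement a (curve a)) := by
    refine InjUpTo.concat (fun s hs t ht hst => h s hs t ht ((isSim_tipMap ha).injective hst))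
      -- The dart part even satisfies the bound `ε / 2`; only `ε` is used, and this is where `0 ≤ ε`
      -- enters.
      (fun s hs t ht hst => (hd s hs t ht ((isSim_sideMap ha).injective hst)).trans
        (by linarith)) fun s hs t ht hst => ?_
    obtain h1 | ⟨⟨⟩, -⟩ := eq_corner_of_nextMap_eq ha tri (hc.mem s hs)
      (dartCurve_mem ha hc.mem t ht) hst
    have h1 : tipMap a (curve a s) = !₂[a, 1 - a ^ 2] := h1
    have h2 := h1
    rw [← tipMap_tri_one] at h2
    refine ⟨curve_eq_one ha hs ((isSim_tipMap ha).injective h2), ?_⟩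
    rw [h1, ← sideMap_dart_zero] at hst
    exact dartCurve_eq_zero ha ht ((isSim_sideMap ha).injective hst).symm
  intro s hs t ht hst
  rw [refinement_curve ha hs, refinement_curve ha ht] at hst
  exact this s hs t ht hst

lemma injUpTo_zero_curve (ha : a ∈ Ioo (0 : ℝ) 1) : InjUpTo 0 (curve a) := by
  have key : ∀ n : ℕ, InjUpTo ((1 / 2) ^ n) (curve a) := fun n => by
    induction n with
    | zero =>
      intro s hs t ht _
      rw [pow_zero, abs_le]
      exact ⟨by linarith [hs.1, ht.2], by linarith [hs.2, ht.1]⟩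
    | succ n ih =>
      have := ih.curve_half ha (by positivity)
      rwa [pow_succ, mul_one_div]
  intro s hs t ht hst
  exact ge_of_tendsto' (tendsto_pow_atTop_nhds_zero_of_lt_one
    (by norm_num : (0 : ℝ) ≤ 1 / 2) (by norm_num)) fun n => key n s hs t ht hst

lemma injOn_rootCurve (ha : a ∈ Ioo (0 : ℝ) 1) : InjOn (rootCurve (curve a)) (Ico 0 1) := by
  have hc := isTriCurve_curve ha
  have hd := dartCurve_mem ha hc.mem
  have hinj : ∀ s ∈ Icc (0 : ℝ) 1, ∀ t ∈ Icc (0 : ℝ) 1,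
      dartCurve (curve a) s = dartCurve (curve a) t → s = t := fun s hs t ht hst => by
    have := (injUpTo_zero_curve ha).dartCurve ha s hs t ht hst
    rw [zero_div] at this
    exact sub_eq_zero.1 (abs_eq_zero.1 (le_antisymm this (abs_nonneg _)))
  -- The two darts meet at `(0, 1)` and `(0, -1)`, reached by the second half at its parameters `1`
  -- and `0`. The former is the excluded end of `Ico 0 1`, the latter is assigned to the first half.
  have hcross : ∀ s ∈ Icc (0 : ℝ) 1, ∀ t ∈ Ioo (0 : ℝ) 1,
      dartCurve (curve a) s ≠ flipX (dartCurve (curve a) (1 - t)) := fun s hs t ht hst => by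
    have ht' := one_sub_mem (Ioo_subset_Icc_self ht)
    obtain h1 | ⟨-, h1⟩ := eq_corner_of_nextMap_eq ha root (hd s hs) (hd _ ht') hst
    · have h1 : dartCurve (curve a) s = !₂[0, 1] := h1
      rw [h1, ← flipX_dart_zero] at hst
      linarith [dartCurve_eq_zero ha ht' ((isSim_flipX a).injective hst).symm, ht.2]
    · rw [h1, ← flipX_dart_one] at hst
      linarith [dartCurve_eq_one ha ht' ((isSim_flipX a).injective hst).symm, ht.1]
  intro s hs t ht hst
  rw [rootCurve, concat, concat] at hst
  split_ifs at hst with h1 h2 h2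
  · linarith [hinj _ ⟨by linarith [hs.1], by linarith⟩ _ ⟨by linarith [ht.1], by linarith⟩ hst]
  · exact absurd hst (hcross _ ⟨by linarith [hs.1], by linarith⟩ _
      ⟨by linarith, by linarith [ht.2]⟩)
  · exact absurd hst.symm (hcross _ ⟨by linarith [ht.1], by linarith⟩ _
      ⟨by linarith, by linarith [hs.2]⟩)
  · linarith [hinj _ ⟨by linarith [hs.2], by linarith⟩ _ ⟨by linarith [ht.2], by linarith⟩
      ((isSim_flipX a).injective hst)]

/-! ### The limit family -/

/-- The images of the limit curves through the three shapes. -/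
def limitSet (a : ℝ) : Shape → Set Plane
  | .root => rootCurve (curve a) '' Icc 0 1
  | .dart => dartCurve (curve a) '' Icc 0 1
  | .tri => curve a '' Icc 0 1

lemma dartCurve_ends (ha : a ∈ Ioo (0 : ℝ) 1) :
    dartCurve (curve a) 0 = !₂[0, 1] ∧ dartCurve (curve a) 1 = !₂[0, -1] := by
  simp only [dartCurve, concat_zero, concat_one, sub_self, (isTriCurve_curve ha).zero,
    flipY_dart_zero, and_self]

/-- The curves were defined by concatenation along exactly these maps, and reversing a parameter
does not change an image. -/
lemma limitSet_eq (ha : a ∈ Ioo (0 : ℝ) 1) (t : Shape) :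
    limitSet a t = t.nextMap a false '' limitSet a (t.next false) ∪
      t.nextMap a true '' limitSet a (t.next true) := by
  have hc := isTriCurve_curve ha
  have hd := dartCurve_ends ha
  cases t <;> simp only [limitSet, next, nextMap, image_id]
  · rw [rootCurve, concat_image, image_comp_one_sub]
    rw [sub_zero, hd.2, flipX_dart_one]
  · rw [dartCurve, concat_image, image_comp_one_sub]
    rw [sub_zero, hc.one, flipY_tri_one]
  · refine (refinement_curve ha).image_eq.trans ?_
    rw [refinement, concat_image, image_image, image_image]
    rw [hc.one, hd.1, tipMap_tri_one, sideMap_dart_zero]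

lemma isLimitFamily_limitSet (ha : a ∈ Ioo (0 : ℝ) 1) : IsLimitFamily a (limitSet a) := by
  have hc := isTriCurve_curve ha
  have hd := dartCurve_mem ha hc.mem
  have hends := dartCurve_ends ha
  have htri : IsCompact (limitSet a .tri) := isCompact_Icc.image_of_continuousOn
    (continuousOn_curve ha)
  have hdart : IsCompact (limitSet a .dart) := by
    rw [limitSet_eq ha]
    exact (htri.image continuous_id).union (htri.image (isSim_flipY a).continuous)
  have hroot : IsCompact (limitSet a .root) := by
    rw [limitSet_eq ha]
    exact (hdart.image continuous_id).union (hdart.image (isSim_flipX a).continuous)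
  refine ⟨fun t => ?_, fun t => ?_, fun t => ?_, limitSet_eq ha⟩
  · cases t
    · exact hroot.isClosed
    · exact hdart.isClosed
    · exact htri.isClosed
  · cases t
    · rintro _ ⟨t, ht, rfl⟩
      exact concat_cases (p := (· ∈ root.region a)) ht
        (fun s hs => nextMap_mem_region ha root false (hd s hs))
        (fun s hs => nextMap_mem_region ha root true (hd _ (one_sub_mem hs)))
    · rintro _ ⟨t, ht, rfl⟩
      exact hd t ht
    · rintro _ ⟨t, ht, rfl⟩
      exact hc.mem t ht
  · have h0 : (!₂[a, 0] : Plane) ∈ limitSet a .tri := ⟨1, by simp, hc.one⟩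
    cases t
    · rw [limitSet_eq ha]
      rintro p (rfl | rfl)
      · exact Or.inl ⟨_, ⟨0, by simp, hends.1⟩, rfl⟩
      · exact Or.inl ⟨_, ⟨1, by simp, hends.2⟩, rfl⟩
    · rw [limitSet_eq ha]
      rintro p rfl
      exact Or.inl ⟨_, h0, rfl⟩
    · rintro p (rfl | rfl)
      · rw [limitSet_eq ha]
        exact Or.inl ⟨_, h0, tipMap_tri_one a⟩
      · exact h0

end Gasket

end

theorem mainTheorem1 :
    (∃ f : ℝ × ℝ → Gasket.Plane,
      ContinuousOn f (Set.Ioo (0 : ℝ) 1 ×ˢ Set.Icc (0 : ℝ) 1) ∧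
      ∀ a ∈ Set.Ioo (0 : ℝ) 1,
        Gasket.IsJordanCurve (fun t => f (a, t)) ∧
        (fun t => f (a, t)) '' Set.Icc (0 : ℝ) 1 = Gasket.gasket a) ∧
    ∀ a ∈ Set.Ioo (0 : ℝ) 1, Gasket.gasket a = closure (Gasket.contactPoints a) := by
  refine ⟨⟨fun x => Gasket.rootCurve (Gasket.curve x.1) x.2, Gasket.continuousOn_rootCurve,
    fun a ha => ⟨⟨?_, ?_, Gasket.injOn_rootCurve ha⟩,
      (Gasket.isLimitFamily_limitSet ha).eq_gasket ha⟩⟩,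
    fun a ha => (Gasket.isLimitFamily_limitSet ha).gasket_eq_closure ha⟩
  · exact Gasket.continuousOn_rootCurve.comp (f := fun t : ℝ => (a, t)) (by fun_prop)
      fun _ ht => ⟨ha, ht⟩
  · simp only [Gasket.rootCurve, Gasket.concat_zero, Gasket.concat_one, sub_self,
      (Gasket.dartCurve_ends ha).1, Gasket.flipX_dart_zero]
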